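/- **Setting.** Let $L>0$, let $n\ge 1$ be an integer, and let $v_1,\dots,v_n:\mathbb R\to\mathbb R$ be continuous. Divide the ring $(0,L]$ into the boxes $B_b=\left(\tfrac{(b-1)L}{n},\tfrac{bL}{n}\right]$, $b=1,\dots,n$. For an even number $N$ of particles let $\mathcal H_N$ be the space of symmetric functions in $L^2((0,L]^N)$. The Hamiltonian of hardcore bosons in the potential $v(t)$ is $$H(t)=-\sum_{j=1}^N\partial_{x_j}^2+\sum_{j=1}^N\sum_{b=1}^n v_b(t)\,\mathbf 1_{B_b}(x_j),$$ acting off the coincidence points on the core of functions $f(x)=g(x)\prod_{i<j}\operatorname{sgn}(x_i-x_j)$, where $g:\mathbb R^N\to\mathbb C$ is $C^2$, antisymmetric, and changes sign when one coordinate is shifted by $L$ (which makes $f$ periodic on the ring, since $N$ is even). The evolution operator $U(t)=\mathcal T\exp\left(-i\int_0^tH(s)\,ds\right)$, $t\in\mathbb R$, is the strongly continuous family of bounded operators on $\mathcal H_N$ with $U(0)=1$ and $\partial_t\langle f,U(t)\Psi\rangle=-i\langle H(t)f,U(t)\Psi\rangle$ for all $\Psi\in\mathcal H_N$ and all $f$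 in the core. Let $K=\{\tfrac{2\pi(m+1/2)}{L}:m\in\mathbb Z\}$ and $K_\otimes=\{(\tfrac{2\pi nm}{L},b):m\in\mathbb Z,\ 1\le b\le n\}$. For $\bar\alpha\in K_\otimes$ write $\alpha$ for its momentum and $b(\bar\alpha)$ for its box. Let $\bar\alpha_1,\dots,\bar\alpha_N\in K_\otimes$ be distinct. For each box $b$ let $J_b=\{j:b(\bar\alpha_j)=b\}$ and $N_b=|J_b|$. The wavelet state $|\bar{\boldsymbol\alpha}\rangle\in\mathcal H_N$ is the tensor product of the box eigenstates: its wave function is $\frac1{\sqrt{N!}}\sum_{\kappa\in\mathfrak S_N}\chi(x_{\kappa 1},\dots,x_{\kappa N})$ with $$\chi(x)=\prod_{b=1}^n\left[\frac{(n/L)^{N_b/2}}{N_b!}\sum_{\sigma\in\mathfrak S(J_b)}(-1)^\sigma e^{\,i\sum_{j\in J_b}x_j\alpha_{\sigma j}}\prod_{i<j\in J_b}\operatorname{sgn}(x_i-x_j)\prod_{j\in J_b}\mathbf 1_{B_b}(x_j)\right].$$ For $\lambda\in K$ and $\bar\alpha,\bar\beta\in K_\otimes$ put $$\varphi(\lambda,\bar\alpha)=\frac{i\sqrt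 n}{L}\cdot\frac{1-e^{iL\lambda/n}}{\lambda-\alpha}\,e^{-iL\,b(\bar\alpha)\lambda/n},\qquad G_t(\bar\alpha,\bar\beta)=\sum_{\lambda\in K}\varphi(\lambda,\bar\alpha)^*\varphi(\lambda,\bar\beta)e^{-it\lambda^2},$$ $$U_t(\bar\alpha,\bar\beta)=\sum_{\bar\gamma\in K_\otimes}G_{-t}(\bar\alpha,\bar\gamma)\,v_{b(\bar\gamma)}(t)\,G_t(\bar\gamma,\bar\beta).$$ **Theorem 1 (Form factors of $U(t)$).** The series defining $G_t$ and $U_t$ converge absolutely. There is exactly one function $\tilde\psi_t(\bar\alpha,\bar\beta)$ of $t\in\mathbb R$ and $\bar\alpha,\bar\beta\in K_\otimes$ such that for each $\bar\beta$ the sum $\sum_{\bar\alpha}|\tilde\psi_t(\bar\alpha,\bar\beta)|^2$ is bounded on bounded time intervals, and $$\partial_t\tilde\psi_t(\bar\alpha,\bar\beta)=-i\sum_{\bar\nu\in K_\otimes}U_t(\bar\alpha,\bar\nu)\tilde\psi_t(\bar\nu,\bar\beta),\qquad\tilde\psi_0(\bar\alpha,\bar\beta)=\delta_{\bar\alpha,\bar\beta}.$$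 The series in this equation, and the series $$\psi_t(\bar\alpha,\bar\beta)=\sum_{\bar\gamma\in K_\otimes}G_t(\bar\alpha,\bar\gamma)\tilde\psi_t(\bar\gamma,\bar\beta),$$ converge absolutely. For every even $N$ the evolution operator $U(t)$ on $\mathcal H_N$ exists and is unique. For all $t\in\mathbb R$ and all wavelet states $|\bar{\boldsymbol\alpha}\rangle,|\bar{\boldsymbol\beta}\rangle$ of $N$ particles, with labels listed so that $b(\bar\alpha_1)\ge\dots\ge b(\bar\alpha_N)$ and $b(\bar\beta_1)\ge\dots\ge b(\bar\beta_N)$, $$\langle\bar{\boldsymbol\alpha}|U(t)|\bar{\boldsymbol\beta}\rangle=\det_{1\le i,j\le N}\psi_t(\bar\alpha_i,\bar\beta_j).$$ -/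

import Mathlib

open MeasureTheory Complex
open scoped ComplexConjugate

noncomputable section

namespace HardcoreBosons

/-! ## The bosonic Hilbert space -/

/-- Lebesgue measure on the configurations of `N` particles on the ring `(0, L]` of length `L`. -/
def ringMeasure (L : ℝ) (N : ℕ) : Measure (Fin N → ℝ) :=
  Measure.pi fun _ => (volume : Measure ℝ).restrict (Set.Ioc 0 L)

instance ringMeasure_isFinite (L : ℝ) (N : ℕ) : IsFiniteMeasure (ringMeasure L N) := by
  unfold ringMeasure
  infer_instance

theorem measurePreserving_perm (L : ℝ) {N : ℕ} (σ : Equiv.Perm (Fin N)) :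
    MeasurePreserving (fun x : Fin N → ℝ => x ∘ σ) (ringMeasure L N) (ringMeasure L N) := by
  have h := measurePreserving_piCongrLeft
    (fun _ : Fin N => (volume : Measure ℝ).restrict (Set.Ioc 0 L)) σ.symm
  have e : (fun x : Fin N → ℝ => x ∘ σ) =
      (MeasurableEquiv.piCongrLeft (fun _ : Fin N => ℝ) σ.symm) := by
    funext x i
    have := MeasurableEquiv.piCongrLeft_apply_apply (β := fun _ : Fin N => ℝ) σ.symm x (σ i)
    simpa using this.symm
  rw [e]
  exact h

/-- The Hilbert space of `N` bosons on the ring: the square integrable wave functions that are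
symmetric under permutations of the particles. -/
def BosonSpace (L : ℝ) (N : ℕ) : Submodule ℂ (Lp ℂ 2 (ringMeasure L N)) where
  carrier := {f | ∀ σ : Equiv.Perm (Fin N),
    (fun x => f (x ∘ σ)) =ᵐ[ringMeasure L N] fun x => f x}
  zero_mem' := by
    intro σ
    have h := Lp.coeFn_zero ℂ 2 (ringMeasure L N)
    have h' := (measurePreserving_perm L σ).quasiMeasurePreserving.ae h
    filter_upwards [h, h'] with x hx hx'
    rw [hx, hx']
    rfl
  add_mem' := by
    intro f g hf hg σ
    have h := Lp.coeFn_add f g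
    have h' := (measurePreserving_perm L σ).quasiMeasurePreserving.ae h
    filter_upwards [h, h', hf σ, hg σ] with x hx hx' h1 h2
    rw [hx, hx', Pi.add_apply, Pi.add_apply, h1, h2]
  smul_mem' := by
    intro c f hf σ
    have h := Lp.coeFn_smul c f
    have h' := (measurePreserving_perm L σ).quasiMeasurePreserving.ae h
    filter_upwards [h, h', hf σ] with x hx hx' h1
    rw [hx, hx', Pi.smul_apply, Pi.smul_apply, h1]

/-- The normalised `N`-particle wave function of the Fock space vector
`∫ dx₁ ⋯ dx_N χ(x₁, …, x_N) φ†(x₁) ⋯ φ†(x_N) |0⟩`. -/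
def bosonize {N : ℕ} (χ : (Fin N → ℝ) → ℂ) (x : Fin N → ℝ) : ℂ :=
  (((Real.sqrt (N.factorial : ℝ))⁻¹ : ℝ) : ℂ) * ∑ κ : Equiv.Perm (Fin N), χ (x ∘ κ)

theorem memLp_bosonize {L : ℝ} {N : ℕ} {χ : (Fin N → ℝ) → ℂ}
    (h : MemLp χ 2 (ringMeasure L N)) : MemLp (bosonize χ) 2 (ringMeasure L N) := by
  unfold bosonize
  refine MemLp.const_mul ?_ _
  refine memLp_finsetSum _ fun κ _ => ?_
  exact h.comp_measurePreserving (measurePreserving_perm L κ)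

theorem bosonize_perm {N : ℕ} (χ : (Fin N → ℝ) → ℂ) (σ : Equiv.Perm (Fin N)) (x : Fin N → ℝ) :
    bosonize χ (x ∘ σ) = bosonize χ x := by
  unfold bosonize
  congr 1
  exact Fintype.sum_equiv (Equiv.mulLeft σ) _ _ fun κ => rfl

/-- The vector `∫ dx₁ ⋯ dx_N χ(x₁, …, x_N) φ†(x₁) ⋯ φ†(x_N) |0⟩` of the `N`-boson space. -/
def ket {L : ℝ} {N : ℕ} (χ : (Fin N → ℝ) → ℂ) (h : MemLp χ 2 (ringMeasure L N)) :
    BosonSpace L N :=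
  ⟨(memLp_bosonize h).toLp (bosonize χ), by
    intro σ
    have h1 := (memLp_bosonize h).coeFn_toLp
    have h2 := (measurePreserving_perm L σ).quasiMeasurePreserving.ae h1
    filter_upwards [h1, h2] with x hx hx'
    rw [hx, hx', bosonize_perm]⟩

/-! ## Wavelet states -/

/-- `∏_{i<j} sgn (x_i - x_j)`. -/
def signProd {ι : Type*} [Fintype ι] [LinearOrder ι] (x : ι → ℝ) : ℝ :=
  ∏ p : ι × ι with p.1 < p.2, Real.sign (x p.1 - x p.2)

/-- The amplitude of the hardcore-boson eigenstate with momenta `k` on an interval of length `ℓ`: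
`1 / (M! ℓ^{M/2}) ∑_σ (-1)^σ exp (i ∑_j x_j k_{σ j}) ∏_{i<j} sgn (x_i - x_j)`,
where `M` is the number of particles. -/
def eigenAmplitude (ℓ : ℝ) {ι : Type*} [Fintype ι] [LinearOrder ι] (k x : ι → ℝ) : ℂ :=
  ((((Fintype.card ι).factorial : ℝ) * Real.sqrt ℓ ^ Fintype.card ι : ℝ) : ℂ)⁻¹ *
    (∑ σ : Equiv.Perm ι, ((Equiv.Perm.sign σ : ℤ) : ℂ) *
      Complex.exp (I * ∑ j, (x j : ℂ) * (k (σ j) : ℂ))) * (signProd x : ℂ)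

/-- The set `K_⊗` of wavelet labels: `(m, b)` stands for the momentum `2π n m / L` in the box `b`.
Boxes are numbered from `0`, so the box index `b` here is the `b + 1` of the usual numbering. -/
abbrev WaveletLabel (n : ℕ) : Type := ℤ × Fin n

/-- The momentum `2π n m / L` of a wavelet label. -/
def momentum (L : ℝ) {n : ℕ} (a : WaveletLabel n) : ℝ := 2 * Real.pi * n * a.1 / L

/-- The `b`-th of the `n` boxes of length `L / n`. -/
def box (L : ℝ) (n : ℕ) (b : Fin n) : Set ℝ :=
  Set.Ioc ((b : ℝ) * (L / n)) (((b : ℝ) + 1) * (L / n))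

/-- The amplitude of the wavelet state with labels `α 0, …, α (N - 1)`: the product over the boxes
`b` of the box eigenstate formed by the particles `j` with label in `b`, all of which are located
in `b`. -/
def waveletAmplitude (L : ℝ) {n N : ℕ} (α : Fin N → WaveletLabel n) (x : Fin N → ℝ) : ℂ :=
  ∏ b : Fin n,
    (eigenAmplitude (L / n) (fun j : {j : Fin N // (α j).2 = b} => momentum L (α j))
        (fun j => x j) *
      ∏ j : {j : Fin N // (α j).2 = b}, (box L n b).indicator (fun _ => (1 : ℂ)) (x j))

theorem measurable_sgn : Measurable Real.sign := by
  have h : Real.sign = fun r : ℝ => if r < 0 then (-1 : ℝ) else if 0 < r then 1 else 0 := by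
    funext r
    rfl
  rw [h]
  exact Measurable.ite measurableSet_Iio measurable_const
    (Measurable.ite measurableSet_Ioi measurable_const measurable_const)

theorem norm_sgn_le (r : ℝ) : ‖Real.sign r‖ ≤ 1 := by
  rcases Real.sign_apply_eq r with h | h | h <;> simp [h]

theorem norm_unit_le (u : ℤˣ) : ‖((u : ℤ) : ℂ)‖ ≤ 1 := by
  rcases Int.units_eq_one_or u with h | h <;> simp [h]

theorem measurable_waveletAmplitude (L : ℝ) {n N : ℕ} (α : Fin N → WaveletLabel n) :
    Measurable (waveletAmplitude L α) := by
  unfold waveletAmplitude eigenAmplitude signProd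
  refine Finset.measurable_prod _ fun b _ => Measurable.mul (Measurable.mul (by fun_prop) ?_) ?_
  · refine Complex.measurable_ofReal.comp (Finset.measurable_prod _ fun p _ => ?_)
    exact measurable_sgn.comp (by fun_prop)
  · refine Finset.measurable_prod _ fun j _ => ?_
    exact (measurable_const.indicator measurableSet_Ioc).comp (measurable_pi_apply _)

theorem bounded_waveletAmplitude (L : ℝ) {n N : ℕ} (α : Fin N → WaveletLabel n) :
    ∃ C : ℝ, ∀ x, ‖waveletAmplitude L α x‖ ≤ C := by
  refine ⟨∏ b : Fin n, (‖((((Fintype.card {j : Fin N // (α j).2 = b}).factorial : ℝ) *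
      Real.sqrt (L / n) ^ Fintype.card {j : Fin N // (α j).2 = b} : ℝ) : ℂ)⁻¹‖ *
      (∑ _σ : Equiv.Perm {j : Fin N // (α j).2 = b}, (1 : ℝ)) * 1 * 1), fun x => ?_⟩
  unfold waveletAmplitude
  rw [norm_prod]
  refine Finset.prod_le_prod (fun _ _ => norm_nonneg _) fun b _ => ?_
  rw [norm_mul]
  refine mul_le_mul ?_ ?_ (norm_nonneg _) (by positivity)
  · unfold eigenAmplitude
    rw [norm_mul, norm_mul]
    refine mul_le_mul (mul_le_mul_of_nonneg_left ?_ (norm_nonneg _)) ?_ (norm_nonneg _)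
      (by positivity)
    · refine (norm_sum_le _ _).trans (Finset.sum_le_sum fun σ _ => ?_)
      rw [norm_mul, Complex.norm_exp]
      have h1 : (I * ∑ j : {j : Fin N // (α j).2 = b},
          ((x j : ℝ) : ℂ) * ((momentum L (α (σ j)) : ℝ) : ℂ)).re = 0 := by
        simp [Complex.mul_re, Complex.im_sum]
      rw [h1, Real.exp_zero, mul_one]
      exact norm_unit_le _
    · unfold signProd
      rw [Complex.norm_real, norm_prod]
      exact Finset.prod_le_one (fun _ _ => norm_nonneg _) fun p _ => norm_sgn_le _
  · rw [norm_prod]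
    refine Finset.prod_le_one (fun _ _ => norm_nonneg _) fun j _ => ?_
    by_cases h : (x j : ℝ) ∈ box L n b
    · rw [Set.indicator_of_mem h]; simp
    · rw [Set.indicator_of_notMem h]; simp

theorem memLp_waveletAmplitude (L : ℝ) {n N : ℕ} (α : Fin N → WaveletLabel n) :
    MemLp (waveletAmplitude L α) 2 (ringMeasure L N) := by
  obtain ⟨C, hC⟩ := bounded_waveletAmplitude L α
  exact MemLp.of_bound (measurable_waveletAmplitude L α).aestronglyMeasurable C
    (Filter.Eventually.of_forall hC)

/-- The wavelet state `|α⟩`. -/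
def waveletState (L : ℝ) {n N : ℕ} (α : Fin N → WaveletLabel n) : BosonSpace L N :=
  ket (waveletAmplitude L α) (memLp_waveletAmplitude L α)

/-! ## The Hamiltonian and the evolution operator -/

/-- A core of the hardcore-boson Hamiltonian on the ring. The wave functions are smooth inside each
ordering of the particles and vanish where two particles meet; they are the products of
`∏_{i<j} sgn (x_i - x_j)` with an antisymmetric `C²` function `g`. Periodicity of the bosonic wave
function on the ring means that `g` picks up the sign `(-1)^(N-1)` (written `(-1)^(N+1)`)
when one particle is taken around the ring past the `N - 1` others. -/
def IsHardcoreTest (L : ℝ) {N : ℕ} (f : (Fin N → ℝ) → ℂ) : Prop :=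
  ∃ g : (Fin N → ℝ) → ℂ, ContDiff ℝ 2 g ∧
    (∀ (σ : Equiv.Perm (Fin N)) (x : Fin N → ℝ),
      g (x ∘ σ) = ((Equiv.Perm.sign σ : ℤ) : ℂ) * g x) ∧
    (∀ (j : Fin N) (x : Fin N → ℝ),
      g (Function.update x j (x j + L)) = (-1 : ℂ) ^ (N + 1) * g x) ∧
    ∀ x, f x = (signProd x : ℂ) * g x

/-- The potential energy `∑_j v_{b(x_j)}` of `N` particles, for the potential that is equal to
`w b` on the box `b`. -/
def potential (L : ℝ) {n N : ℕ} (w : Fin n → ℝ) (x : Fin N → ℝ) : ℝ :=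
  ∑ j : Fin N, ∑ b : Fin n, (box L n b).indicator (fun _ => w b) (x j)

/-- The action `-∑_j ∂_j² f + V f` of the Hamiltonian `H_0 + V` on a wave function `f` (used on
the core, where the derivatives exist off the null set of coinciding particles). -/
def hamiltonian (L : ℝ) {n N : ℕ} (w : Fin n → ℝ) (f : (Fin N → ℝ) → ℂ) (x : Fin N → ℝ) : ℂ :=
  -(∑ j : Fin N, iteratedDeriv 2 (fun s : ℝ => f (Function.update x j s)) (x j)) +
    (potential L w x : ℂ) * f x

/-- `U` is the evolution operator (time-ordered exponential) of the time-dependent hardcore-boson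
Hamiltonian `H(t) = H_0 + V(t)`, i.e. `U 0 = 1`, `U` is strongly continuous, and
`i ∂_t U(t) = H(t) U(t)` holds weakly against the core of `H_0`. -/
structure IsEvolutionOperator (L : ℝ) {n : ℕ} (v : Fin n → ℝ → ℝ) (N : ℕ)
    (U : ℝ → BosonSpace L N →L[ℂ] BosonSpace L N) : Prop where
  initial : U 0 = ContinuousLinearMap.id ℂ (BosonSpace L N)
  continuous : ∀ Ψ : BosonSpace L N, Continuous fun t => U t Ψ
  schrodinger : ∀ (Ψ : BosonSpace L N) (f : (Fin N → ℝ) → ℂ), IsHardcoreTest L f → ∀ t : ℝ,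
    HasDerivAt
      (fun s => ∫ x, conj (f x) * (U s Ψ : Lp ℂ 2 (ringMeasure L N)) x ∂(ringMeasure L N))
      (-I * ∫ x, conj (hamiltonian L (fun b => v b t) f x) *
        (U t Ψ : Lp ℂ 2 (ringMeasure L N)) x ∂(ringMeasure L N)) t

/-! ## The single-particle functions -/

/-- The momenta `2π (m + 1/2) / L`, `m ∈ ℤ`, of the set `K` (for an even number of particles). -/
def ringMomentum (L : ℝ) (m : ℤ) : ℝ := 2 * Real.pi * ((m : ℝ) + 1 / 2) / L

/-- `φ(λ, α) = (i √n / L) (1 - e^{i L λ / n}) / (λ - α) e^{-i L b(α) λ / n}`,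
where `b(α) ∈ {1, …, n}`. -/
def overlap (L : ℝ) {n : ℕ} (l : ℝ) (a : WaveletLabel n) : ℂ :=
  I * (Real.sqrt n : ℂ) / (L : ℂ) *
    ((1 - Complex.exp (I * (L : ℂ) * (l : ℂ) / (n : ℂ))) / ((l : ℂ) - (momentum L a : ℂ))) *
    Complex.exp (-(I * (L : ℂ) * (((a.2 : ℕ) : ℂ) + 1) / (n : ℂ) * (l : ℂ)))

/-- The term `φ(λ, α)^* φ(λ, β) e^{-i t λ²}` for the `m`-th element `λ` of `K`. -/
def greenTerm (L : ℝ) {n : ℕ} (t : ℝ) (a c : WaveletLabel n) (m : ℤ) : ℂ :=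
  conj (overlap L (ringMomentum L m) a) * overlap L (ringMomentum L m) c *
    Complex.exp (-(I * (t : ℂ) * (ringMomentum L m : ℂ) ^ 2))

/-- `G_t(α, β) = ∑_{λ ∈ K} φ(λ, α)^* φ(λ, β) e^{-i t λ²}`. -/
def green (L : ℝ) {n : ℕ} (t : ℝ) (a c : WaveletLabel n) : ℂ :=
  ∑' m : ℤ, greenTerm L t a c m

/-- `U_t(α, β) = ∑_γ G_{-t}(α, γ) v_{b(γ)}(t) G_t(γ, β)`. -/
def generator (L : ℝ) {n : ℕ} (v : Fin n → ℝ → ℝ) (t : ℝ) (a c : WaveletLabel n) : ℂ :=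
  ∑' g : WaveletLabel n, green L (-t) a g * (v g.2 t : ℂ) * green L t g c

/-- `ψt` is a solution, with columns in `ℓ²` (locally uniformly in time), of
`∂_t ψt_t(α, β) = -i ∑_ν U_t(α, ν) ψt_t(ν, β)`, `ψt_0(α, β) = δ_{α, β}`. -/
structure IsInteractionSolution (L : ℝ) {n : ℕ} (v : Fin n → ℝ → ℝ)
    (ψt : ℝ → WaveletLabel n → WaveletLabel n → ℂ) : Prop where
  initial : ∀ a c, ψt 0 a c = if a = c then 1 else 0
  bounded : ∀ (T : ℝ) (c : WaveletLabel n), ∃ C : ℝ, ∀ t : ℝ, |t| ≤ T →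
    Summable (fun a => ‖ψt t a c‖ ^ 2) ∧ ∑' a, ‖ψt t a c‖ ^ 2 ≤ C
  deriv : ∀ (t : ℝ) (a c : WaveletLabel n),
    HasDerivAt (fun s => ψt s a c) (-I * ∑' ν, generator L v t a ν * ψt t ν c) t

/-- `ψ_t(α, β) = ∑_γ G_t(α, γ) ψt_t(γ, β)`. -/
def psi (L : ℝ) {n : ℕ} (ψt : ℝ → WaveletLabel n → WaveletLabel n → ℂ) (t : ℝ)
    (a c : WaveletLabel n) : ℂ :=
  ∑' g : WaveletLabel n, green L t a g * ψt t g c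

end HardcoreBosons

end

/-!
The evolution is the interaction-picture propagator followed by the free evolution. The propagator
is given by a Dyson series, since its generator is bounded, and a locally bounded weak solution of
its equation is Lipschitz, hence a strong solution, hence unique by Grönwall.

For one particle on the ring, the antiperiodic plane waves with momenta in `K` and the wavelets are
two Hilbert bases, and `φ` is their overlap. So `G_t`, `U_t`, `ψ̃_t` and `ψ_t` are the matrices, in
the wavelet basis, of the free evolution, of the interaction-picture generator, of its propagator
and of the full evolution.

Multiplication by `∏_{i<j} sgn (x_i - x_j)` maps hardcore bosons to free fermions, antiperiodic for
even `N`, and the core to smooth antisymmetric functions, on which integration by parts shows that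
the Hamiltonian is the sum of one-particle Hamiltonians. The `N`-particle evolution is therefore a
tensor power of the one-particle evolution. For labels ordered by their boxes the sign factors
between different boxes are equal to `1`, and the Slater matrix of the wavelets is block diagonal,
so the sign factor also maps a wavelet state to the Slater determinant of its wavelets. The matrix
element of a tensor power between two Slater determinants is a determinant.
-/

open MeasureTheory Complex
open scoped ComplexConjugate

noncomputable section

namespace HardcoreBosons

/-! ## Linear evolution equations -/

/-- Boundedness on bounded time intervals. -/
def LocallyBounded {F : Type*} [Norm F] (y : ℝ → F) : Prop :=
  ∀ T : ℝ, ∃ M, ∀ t, |t| ≤ T → ‖y t‖ ≤ M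

theorem locallyBounded_of_continuous {F : Type*} [SeminormedAddCommGroup F] {y : ℝ → F}
    (hy : Continuous y) : LocallyBounded y := fun T => by
  obtain ⟨M, hM⟩ := (isCompact_Icc (a := -T) (b := T)).exists_bound_of_continuousOn hy.continuousOn
  exact ⟨M, fun t ht => hM t (abs_le.mp ht)⟩

section Dyson

variable {E : Type*} [NormedAddCommGroup E] [NormedSpace ℂ E]

/-- Continuity of a time-dependent bounded operator in the strong operator topology. -/
def StronglyContinuous (B : ℝ → E →L[ℂ] E) : Prop := ∀ x, Continuous fun t => B t x

variable {B : ℝ → E →L[ℂ] E}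

theorem StronglyContinuous.of_continuous (hB : Continuous B) : StronglyContinuous B :=
  fun _ => hB.clm_apply continuous_const

/-- The terms of the Dyson series `∑_k ∫_{0 ≤ s_1 ≤ ⋯ ≤ s_k ≤ t} B(s_k) ⋯ B(s_1) x`, which solves
`y' = B y`, `y 0 = x`. -/
def dysonTerm (B : ℝ → E →L[ℂ] E) (x : E) : ℕ → ℝ → E
  | 0 => fun _ => x
  | k + 1 => fun t => ∫ s in (0 : ℝ)..t, B s (dysonTerm B x k s)

theorem dysonTerm_succ_zero (x : E) (k : ℕ) : dysonTerm B x (k + 1) 0 = 0 :=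
  intervalIntegral.integral_same

theorem dysonTerm_smul (c : ℂ) (x : E) (k : ℕ) :
    dysonTerm B (c • x) k = c • dysonTerm B x k := by
  induction k with
  | zero => rfl
  | succ k ih =>
    funext t
    simp only [dysonTerm, Pi.smul_apply, ih, map_smul]
    exact intervalIntegral.integral_smul c _

variable [CompleteSpace E]

theorem StronglyContinuous.locallyBounded (hB : StronglyContinuous B) : LocallyBounded B := by
  intro T
  obtain ⟨C, hC⟩ := banach_steinhaus (g := fun t : Set.Icc (-T) T => B t) fun x => by
    obtain ⟨M, hM⟩ := locallyBounded_of_continuous (hB x) T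
    exact ⟨M, fun t => hM t (abs_le.mpr t.2)⟩
  exact ⟨C, fun t ht => hC ⟨t, abs_le.mp ht⟩⟩

theorem StronglyContinuous.continuous_apply (hB : StronglyContinuous B) {y : ℝ → E}
    (hy : Continuous y) : Continuous fun t => B t (y t) := by
  refine continuous_iff_continuousAt.mpr fun t => ?_
  obtain ⟨C, hC⟩ := hB.locallyBounded (|t| + 1)
  have hnear : ∀ᶠ s in nhds t, |s| ≤ |t| + 1 :=
    continuous_abs.continuousAt.eventually (Iic_mem_nhds (lt_add_one |t|))
  have hzero : Filter.Tendsto (fun s => C * ‖y s - y t‖) (nhds t) (nhds 0) := by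
    simpa using ((hy.tendsto t).sub_const (y t)).norm.const_mul C
  have hdiff : Filter.Tendsto (fun s => B s (y s - y t)) (nhds t) (nhds 0) :=
    squeeze_zero_norm' (hnear.mono fun s hs => (B s).le_of_opNorm_le (hC s hs) _) hzero
  simpa [ContinuousAt] using hdiff.add ((hB (y t)).tendsto t)

theorem StronglyContinuous.comp {A : ℝ → E →L[ℂ] E} (hA : StronglyContinuous A)
    (hB : StronglyContinuous B) : StronglyContinuous fun t => (A t).comp (B t) :=
  fun x => hA.continuous_apply (hB x)

theorem continuous_dysonTerm (hB : StronglyContinuous B) (x : E) (k : ℕ) :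
    Continuous (dysonTerm B x k) := by
  induction k with
  | zero => exact continuous_const
  | succ k ih =>
    exact intervalIntegral.continuous_primitive
      (fun a b => (hB.continuous_apply ih).intervalIntegrable a b) 0

theorem continuous_apply_dysonTerm (hB : StronglyContinuous B) (x : E) (k : ℕ) :
    Continuous fun s => B s (dysonTerm B x k s) :=
  hB.continuous_apply (continuous_dysonTerm hB x k)

theorem hasDerivAt_dysonTerm_succ (hB : StronglyContinuous B) (x : E) (k : ℕ) (t : ℝ) :
    HasDerivAt (dysonTerm B x (k + 1)) (B t (dysonTerm B x k t)) t :=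
  (continuous_apply_dysonTerm hB x k).integral_hasStrictDerivAt 0 t |>.hasDerivAt

theorem norm_dysonTerm_le (hB : StronglyContinuous B) {T C : ℝ} (hC : ∀ t, |t| ≤ T → ‖B t‖ ≤ C)
    (x : E) (k : ℕ) {t : ℝ} (ht : |t| ≤ T) :
    ‖dysonTerm B x k t‖ ≤ ‖x‖ * ((C * |t|) ^ k / k.factorial) := by
  induction k generalizing t with
  | zero => simp [dysonTerm]
  | succ k ih =>
    have hintegrand : ∀ s ∈ Set.uIoc 0 t,
        ‖B s (dysonTerm B x k s)‖ ≤ C * ‖x‖ * (C ^ k / k.factorial) * |s - 0| ^ k := fun s hs => by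
      have hsT : |s| ≤ T := by
        have hst := Set.abs_sub_left_of_mem_uIcc (Set.uIoc_subset_uIcc hs)
        rw [sub_zero, sub_zero] at hst
        exact hst.trans ht
      calc ‖B s (dysonTerm B x k s)‖ ≤ C * (‖x‖ * ((C * |s|) ^ k / k.factorial)) :=
            (B s).le_of_opNorm_le_of_le (hC s hsT) (ih hsT)
        _ = _ := by rw [sub_zero, mul_pow]; ring
    calc ‖∫ s in (0 : ℝ)..t, B s (dysonTerm B x k s)‖
        ≤ ∫ s in Set.uIoc 0 t, ‖B s (dysonTerm B x k s)‖ :=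
          intervalIntegral.norm_integral_le_integral_norm_uIoc
      _ ≤ ∫ s in Set.uIoc 0 t, C * ‖x‖ * (C ^ k / k.factorial) * |s - 0| ^ k :=
          setIntegral_mono_on
            ((continuous_apply_dysonTerm hB x k).norm.intervalIntegrable 0 t).def'
            (Continuous.intervalIntegrable (by fun_prop) 0 t).def' measurableSet_uIoc hintegrand
      _ = ‖x‖ * ((C * |t|) ^ (k + 1) / (k + 1).factorial) := by
          rw [integral_const_mul, integral_pow_abs_sub_uIoc, sub_zero, Nat.factorial_succ, mul_pow]
          push_cast
          field_simp
          ring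

theorem norm_dysonTerm_le_of_abs_le (hB : StronglyContinuous B) {T C : ℝ}
    (hC : ∀ t, |t| ≤ T → ‖B t‖ ≤ C) (x : E) (k : ℕ) {t : ℝ} (ht : |t| ≤ T) :
    ‖dysonTerm B x k t‖ ≤ ‖x‖ * ((C * T) ^ k / k.factorial) := by
  have hC0 : 0 ≤ C := (norm_nonneg _).trans (hC t ht)
  refine (norm_dysonTerm_le hB hC x k ht).trans ?_
  gcongr

theorem summable_dysonTerm (hB : StronglyContinuous B) (x : E) (t : ℝ) :
    Summable fun k => dysonTerm B x k t := by
  obtain ⟨C, hC⟩ := hB.locallyBounded |t|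
  exact Summable.of_norm_bounded ((Real.summable_pow_div_factorial (C * |t|)).mul_left ‖x‖)
    fun k => norm_dysonTerm_le hB hC x k le_rfl

theorem exists_norm_tsum_dysonTerm_le (hB : StronglyContinuous B) (t : ℝ) :
    ∃ C, ∀ x, ‖∑' k, dysonTerm B x k t‖ ≤ C * ‖x‖ := by
  obtain ⟨C, hC⟩ := hB.locallyBounded |t|
  refine ⟨∑' k : ℕ, (C * |t|) ^ k / k.factorial, fun x => ?_⟩
  rw [mul_comm, ← tsum_mul_left]
  exact tsum_of_norm_bounded ((Real.summable_pow_div_factorial (C * |t|)).mul_left ‖x‖).hasSum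
    fun k => norm_dysonTerm_le hB hC x k le_rfl

theorem dysonTerm_add (hB : StronglyContinuous B) (x y : E) (k : ℕ) :
    dysonTerm B (x + y) k = dysonTerm B x k + dysonTerm B y k := by
  induction k with
  | zero => rfl
  | succ k ih =>
    funext t
    simp only [dysonTerm, Pi.add_apply, ih, map_add]
    exact intervalIntegral.integral_add
      ((continuous_apply_dysonTerm hB x k).intervalIntegrable _ _)
      ((continuous_apply_dysonTerm hB y k).intervalIntegrable _ _)

/-- The propagator of `y' = B y`, as the sum of the Dyson series. -/
def propagator (hB : StronglyContinuous B) (t : ℝ) : E →L[ℂ] E :=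
  LinearMap.mkContinuousOfExistsBound
    { toFun := fun x => ∑' k, dysonTerm B x k t
      map_add' := fun x y => by
        simp only [dysonTerm_add hB, Pi.add_apply]
        exact (summable_dysonTerm hB x t).tsum_add (summable_dysonTerm hB y t)
      map_smul' := fun c x => by
        simp only [dysonTerm_smul, Pi.smul_apply, RingHom.id_apply]
        exact (summable_dysonTerm hB x t).tsum_const_smul c }
    (exists_norm_tsum_dysonTerm_le hB t)

theorem propagator_apply (hB : StronglyContinuous B) (t : ℝ) (x : E) :
    propagator hB t x = x + ∑' k, dysonTerm B x (k + 1) t :=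
  (summable_dysonTerm hB x t).tsum_eq_zero_add

theorem propagator_zero (hB : StronglyContinuous B) (x : E) : propagator hB 0 x = x := by
  simp [propagator_apply, dysonTerm_succ_zero]

theorem hasDerivAt_propagator (hB : StronglyContinuous B) (x : E) (t : ℝ) :
    HasDerivAt (fun s => propagator hB s x) (B t (propagator hB t x)) t := by
  obtain ⟨C, hC⟩ := hB.locallyBounded (|t| + 1)
  have habs : ∀ s ∈ Metric.ball (0 : ℝ) (|t| + 1), |s| ≤ |t| + 1 := fun s hs => by
    simpa using (Metric.mem_ball.mp hs).le
  have hbound : ∀ k : ℕ, ∀ s ∈ Metric.ball (0 : ℝ) (|t| + 1), ‖B s (dysonTerm B x k s)‖ ≤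
      C * (‖x‖ * ((C * (|t| + 1)) ^ k / k.factorial)) := fun k s hs =>
    (B s).le_of_opNorm_le_of_le (hC s (habs s hs))
      (norm_dysonTerm_le_of_abs_le hB hC x k (habs s hs))
  have htail : HasDerivAt (fun s => ∑' k, dysonTerm B x (k + 1) s)
      (∑' k, B t (dysonTerm B x k t)) t :=
    hasDerivAt_tsum_of_isPreconnected
      (((Real.summable_pow_div_factorial (C * (|t| + 1))).mul_left ‖x‖).mul_left C)
      Metric.isOpen_ball (convex_ball (0 : ℝ) (|t| + 1)).isPreconnected
      (fun k s _ => hasDerivAt_dysonTerm_succ hB x k s) hbound (y₀ := t) (by simp)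
      ((summable_nat_add_iff 1).mpr (summable_dysonTerm hB x t)) (by simp)
  simp only [propagator_apply hB _ x]
  rw [← propagator_apply hB, show propagator hB t x = ∑' k, dysonTerm B x k t from rfl,
    (B t).map_tsum (summable_dysonTerm hB x t)]
  exact htail.const_add x

theorem stronglyContinuous_propagator (hB : StronglyContinuous B) :
    StronglyContinuous (propagator hB) := fun x =>
  continuous_iff_continuousAt.mpr fun t => (hasDerivAt_propagator hB x t).continuousAt

theorem eq_propagator_of_hasDerivAt (hB : StronglyContinuous B) {y : ℝ → E}
    (hy : ∀ t, HasDerivAt y (B t (y t)) t) (t : ℝ) : y t = propagator hB t (y 0) := by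
  obtain ⟨C, hC⟩ := hB.locallyBounded (|t| + 1)
  have hIoo : ∀ s ∈ Set.Ioo (-(|t| + 1)) (|t| + 1), |s| ≤ |t| + 1 := fun s hs =>
    abs_le.mpr ⟨hs.1.le, hs.2.le⟩
  refine ODE_solution_unique_of_mem_Ioo (v := fun s x => B s x) (s := fun _ => Set.univ)
    (K := C.toNNReal) (t₀ := 0) (fun s hs => ?_) ?_ (fun s _ => ⟨hy s, trivial⟩)
    (fun s _ => ⟨hasDerivAt_propagator hB (y 0) s, trivial⟩) (propagator_zero hB (y 0)).symm
    (abs_lt.mp (lt_add_one |t|))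
  · exact ((B s).lipschitz.weaken
      (NNReal.le_toNNReal_of_coe_le (hC s (hIoo s hs)))).lipschitzOnWith
  · exact ⟨by linarith [abs_nonneg t], by positivity⟩

end Dyson

section WeakSolutions

variable {H : Type*} [NormedAddCommGroup H] [InnerProductSpace ℂ H] {κ : Type*} {w : κ → H}

theorem eq_of_forall_inner_eq (hw : Dense (Submodule.span ℂ (Set.range w) : Set H)) {x y : H}
    (h : ∀ i, inner ℂ (w i) x = inner ℂ (w i) y) : x = y := by
  refine hw.eq_of_inner_right ℂ fun f hf => ?_
  induction hf using Submodule.span_induction with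
  | mem f hf => obtain ⟨i, rfl⟩ := hf; exact h i
  | zero => simp
  | add f g _ _ hf hg => rw [inner_add_left, inner_add_left, hf, hg]
  | smul c f _ hf => rw [inner_smul_left, inner_smul_left, hf]

theorem norm_le_of_forall_norm_inner_le {S : Set H} (hS : Dense S) {x : H} {C : ℝ} (hC : 0 ≤ C)
    (h : ∀ f ∈ S, ‖inner ℂ f x‖ ≤ C * ‖f‖) : ‖x‖ ≤ C := by
  have hx : ‖inner ℂ x x‖ ≤ C * ‖x‖ :=
    hS.induction (P := fun f => ‖inner ℂ f x‖ ≤ C * ‖f‖) h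
      (isClosed_le (by fun_prop) (by fun_prop)) x
  rcases (norm_nonneg x).eq_or_lt with h0 | hpos
  · rwa [← h0]
  · rw [inner_self_eq_norm_sq_to_K, norm_pow, RCLike.norm_ofReal, abs_norm, sq] at hx
    exact le_of_mul_le_mul_right hx hpos

theorem hasDerivAt_inner_const_left (f : H) {y : ℝ → H} {y' : H} {t : ℝ} (hy : HasDerivAt y y' t) :
    HasDerivAt (fun s => inner ℂ f (y s)) (inner ℂ f y') t :=
  ((innerSL ℂ f).restrictScalars ℝ).hasFDerivAt.comp_hasDerivAt t hy

theorem hasDerivAt_inner_of_mem_span {y g : ℝ → H}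
    (hd : ∀ i t, HasDerivAt (fun s => inner ℂ (w i) (y s)) (inner ℂ (w i) (g t)) t)
    {f : H} (hf : f ∈ Submodule.span ℂ (Set.range w)) (t : ℝ) :
    HasDerivAt (fun s => inner ℂ f (y s)) (inner ℂ f (g t)) t := by
  induction hf using Submodule.span_induction with
  | mem f hf => obtain ⟨i, rfl⟩ := hf; exact hd i t
  | zero => simpa using hasDerivAt_const t (0 : ℂ)
  | add f g _ _ hf hg => simpa only [inner_add_left] using hf.fun_add hg
  | smul c f _ hf => simpa only [inner_smul_left] using hf.const_mul _

theorem continuous_of_hasDerivAt_inner (hw : Dense (Submodule.span ℂ (Set.range w) : Set H))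
    {y g : ℝ → H} (hg : LocallyBounded g)
    (hd : ∀ i t, HasDerivAt (fun s => inner ℂ (w i) (y s)) (inner ℂ (w i) (g t)) t) :
    Continuous y := by
  refine continuous_iff_continuousAt.mpr fun t => ?_
  obtain ⟨M, hM⟩ := hg (|t| + 1)
  have hM' : ∀ s ∈ Set.Icc (-(|t| + 1)) (|t| + 1), ‖g s‖ ≤ M := fun s hs => hM s (abs_le.mpr hs)
  have ht : t ∈ Set.Ioo (-(|t| + 1)) (|t| + 1) := abs_lt.mp (lt_add_one |t|)
  have hM0 : 0 ≤ M := (norm_nonneg _).trans (hM' t (Set.Ioo_subset_Icc_self ht))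
  have hlip : LipschitzOnWith M.toNNReal y (Set.Icc (-(|t| + 1)) (|t| + 1)) := by
    refine LipschitzOnWith.of_dist_le_mul fun s hs r hr => ?_
    rw [Real.coe_toNNReal M hM0, dist_eq_norm, dist_eq_norm]
    refine norm_le_of_forall_norm_inner_le hw (by positivity) fun f hf => ?_
    rw [inner_sub_right]
    calc ‖inner ℂ f (y s) - inner ℂ f (y r)‖ ≤ ‖f‖ * M * ‖s - r‖ :=
          (convex_Icc _ _).norm_image_sub_le_of_norm_hasDerivWithin_le
            (fun q _ => (hasDerivAt_inner_of_mem_span hd hf q).hasDerivWithinAt)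
            (fun q hq => (norm_inner_le_norm _ _).trans (by gcongr; exact hM' q hq)) hr hs
      _ = M * ‖s - r‖ * ‖f‖ := by ring
  exact hlip.continuousOn.continuousAt (Icc_mem_nhds ht.1 ht.2)

variable [CompleteSpace H]

theorem hasDerivAt_of_forall_hasDerivAt_inner
    (hw : Dense (Submodule.span ℂ (Set.range w) : Set H)) {y g : ℝ → H} (hg : Continuous g)
    (hd : ∀ i t, HasDerivAt (fun s => inner ℂ (w i) (y s)) (inner ℂ (w i) (g t)) t) (t : ℝ) :
    HasDerivAt y (g t) t := by
  have hprim : ∀ t, HasDerivAt (fun t => y 0 + ∫ s in (0 : ℝ)..t, g s) (g t) t := fun t =>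
    (hg.integral_hasStrictDerivAt 0 t).hasDerivAt.const_add (y 0)
  suffices heq : y = fun t => y 0 + ∫ s in (0 : ℝ)..t, g s by rw [heq]; exact hprim t
  funext t
  refine eq_of_forall_inner_eq hw fun i => ?_
  have hprim' := fun s => hasDerivAt_inner_const_left (w i) (hprim s)
  refine congrFun (eq_of_fderiv_eq (𝕜 := ℝ) (fun s => (hd i s).differentiableAt)
    (fun s => (hprim' s).differentiableAt) (fun s => ?_) 0 (by simp)) t
  rw [(hd i s).hasFDerivAt.fderiv, (hprim' s).hasFDerivAt.fderiv]

theorem eq_propagator_of_weak_solution (hw : Dense (Submodule.span ℂ (Set.range w) : Set H))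
    {B : ℝ → H →L[ℂ] H} (hB : StronglyContinuous B) {y : ℝ → H} (hy : LocallyBounded y)
    (hd : ∀ i t, HasDerivAt (fun s => inner ℂ (w i) (y s)) (inner ℂ (w i) (B t (y t))) t) (t : ℝ) :
    y t = propagator hB t (y 0) := by
  have hBy : LocallyBounded fun t => B t (y t) := fun T => by
    obtain ⟨C, hC⟩ := hB.locallyBounded T
    obtain ⟨M, hM⟩ := hy T
    exact ⟨C * M, fun t ht => (B t).le_of_opNorm_le_of_le (hC t ht) (hM t ht)⟩
  exact eq_propagator_of_hasDerivAt hB (hasDerivAt_of_forall_hasDerivAt_inner hw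
    (hB.continuous_apply (continuous_of_hasDerivAt_inner hw hBy hd)) hd) t

end WeakSolutions

/-! ## Evolution in the interaction picture -/

section Evolution

variable {H : Type*} [NormedAddCommGroup H] [InnerProductSpace ℂ H] {ι : Type*}

/-- Multiplication of `ℓ²` sequences by phases. -/
def phaseMul (c : ι → ℂ) (hc : ∀ i, ‖c i‖ = 1) :
    lp (fun _ : ι => ℂ) 2 →ₗᵢ[ℂ] lp (fun _ : ι => ℂ) 2 where
  toFun x := ⟨fun i => c i * x i, (lp.memℓp x).mono' fun i => by simp [hc]⟩
  map_add' x y := by ext i; exact mul_add _ _ _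
  map_smul' r x := by ext i; simp [mul_left_comm]
  norm_map' x := by
    have h2 : (0 : ℝ) < (2 : ENNReal).toReal := by simp
    change ‖(⟨fun i => c i * x i, _⟩ : lp (fun _ : ι => ℂ) 2)‖ = ‖x‖
    simp [lp.norm_eq_tsum_rpow h2, hc]

/-- The unitary group `exp (-i t H₀)` of the operator `H₀` that is diagonal in the Hilbert
basis `b`, with eigenvalues `E`. -/
def freeEvolution (b : HilbertBasis ι ℂ H) (E : ι → ℝ) (t : ℝ) : H →L[ℂ] H :=
  ((b.repr.symm.toLinearIsometry.comp
    (phaseMul (fun i => Complex.exp (-(I * t * E i))) fun i => by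
      rw [Complex.norm_exp]; simp)).comp b.repr.toLinearIsometry).toContinuousLinearMap

variable (b : HilbertBasis ι ℂ H) (E : ι → ℝ)

theorem dense_span_range_hilbertBasis : Dense (Submodule.span ℂ (Set.range b) : Set H) :=
  Submodule.dense_iff_topologicalClosure_eq_top.mpr b.dense_span

theorem norm_freeEvolution_apply (t : ℝ) (x : H) : ‖freeEvolution b E t x‖ = ‖x‖ :=
  LinearIsometry.norm_map _ x

theorem inner_freeEvolution (t : ℝ) (i : ι) (x : H) :
    inner ℂ (b i) (freeEvolution b E t x) = Complex.exp (-(I * t * E i)) * inner ℂ (b i) x := by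
  rw [← b.repr_apply_apply, ← b.repr_apply_apply]
  simp [freeEvolution, phaseMul]

theorem freeEvolution_add (s t : ℝ) (x : H) :
    freeEvolution b E (s + t) x = freeEvolution b E s (freeEvolution b E t x) := by
  refine eq_of_forall_inner_eq (dense_span_range_hilbertBasis b) fun i => ?_
  simp only [inner_freeEvolution]
  rw [← mul_assoc, ← Complex.exp_add]
  congr 2
  push_cast
  ring

theorem freeEvolution_zero (x : H) : freeEvolution b E 0 x = x :=
  eq_of_forall_inner_eq (dense_span_range_hilbertBasis b) fun i => by simp [inner_freeEvolution]

theorem freeEvolution_apply_neg (t : ℝ) (x : H) :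
    freeEvolution b E t (freeEvolution b E (-t) x) = x := by
  rw [← freeEvolution_add, add_neg_cancel, freeEvolution_zero]

theorem inner_freeEvolution_right (t : ℝ) (x y : H) :
    inner ℂ x (freeEvolution b E t y) = inner ℂ (freeEvolution b E (-t) x) y := by
  have h : inner ℂ (freeEvolution b E t (freeEvolution b E (-t) x)) (freeEvolution b E t y) =
      inner ℂ (freeEvolution b E (-t) x) y := LinearIsometry.inner_map_map _ _ _
  rwa [freeEvolution_apply_neg] at h

theorem freeEvolution_basis (t : ℝ) (i : ι) :
    freeEvolution b E t (b i) = Complex.exp (-(I * t * E i)) • b i := by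
  refine eq_of_forall_inner_eq (dense_span_range_hilbertBasis b) fun j => ?_
  rw [inner_freeEvolution, inner_smul_right]
  by_cases h : j = i
  · rw [h]
  · rw [b.orthonormal.2 h, mul_zero, mul_zero]

theorem stronglyContinuous_freeEvolution : StronglyContinuous (freeEvolution b E) := by
  have hspan : ∀ f ∈ Submodule.span ℂ (Set.range b), Continuous fun t => freeEvolution b E t f := by
    intro f hf
    induction hf using Submodule.span_induction with
    | mem f hf =>
      obtain ⟨i, rfl⟩ := hf
      simp only [freeEvolution_basis]
      fun_prop
    | zero => simpa using continuous_const
    | add f g _ _ hf hg => simpa only [map_add] using hf.fun_add hg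
    | smul c f _ hf => simpa only [map_smul] using hf.fun_const_smul c
  refine fun x => continuous_of_uniform_approx_of_continuous fun u hu => ?_
  obtain ⟨ε, hε, hεu⟩ := Metric.mem_uniformity_dist.mp hu
  obtain ⟨f, hf, hfx⟩ := (dense_span_range_hilbertBasis b).exists_dist_lt x hε
  refine ⟨_, hspan f hf, fun t => hεu ?_⟩
  rwa [dist_eq_norm, ← map_sub, norm_freeEvolution_apply, ← dist_eq_norm]

/-- The generator `-i exp (i t H₀) V(t) exp (-i t H₀)` of the evolution in the interaction
picture. -/
def interactionGenerator (V : ℝ → H →L[ℂ] H) (t : ℝ) : H →L[ℂ] H :=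
  (-I) • ((freeEvolution b E (-t)).comp ((V t).comp (freeEvolution b E t)))

theorem interactionGenerator_apply (V : ℝ → H →L[ℂ] H) (t : ℝ) (x : H) :
    interactionGenerator b E V t x =
      (-I) • freeEvolution b E (-t) (V t (freeEvolution b E t x)) := rfl

variable [CompleteSpace H] {V : ℝ → H →L[ℂ] H}

theorem hasDerivAt_freeEvolution {f h : H}
    (hfh : ∀ i, inner ℂ (b i) h = (E i : ℂ) * inner ℂ (b i) f) (t : ℝ) :
    HasDerivAt (fun s => freeEvolution b E s f) ((-I) • freeEvolution b E t h) t := by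
  refine hasDerivAt_of_forall_hasDerivAt_inner (g := fun t => (-I) • freeEvolution b E t h)
    (dense_span_range_hilbertBasis b)
    ((stronglyContinuous_freeEvolution b E h).const_smul (-I)) (fun i r => ?_) t
  simp only [inner_freeEvolution, inner_smul_right, hfh]
  have hphase : HasDerivAt (fun s : ℝ => -(I * (s : ℂ) * (E i : ℂ))) (-(I * 1 * (E i : ℂ))) r :=
    (((hasDerivAt_id r).ofReal_comp.const_mul I).mul_const _).fun_neg
  refine (hphase.cexp.mul_const _).congr_deriv ?_
  ring

theorem stronglyContinuous_interactionGenerator (hV : StronglyContinuous V) :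
    StronglyContinuous (interactionGenerator b E V) := fun x =>
  ((StronglyContinuous.comp (fun x => (stronglyContinuous_freeEvolution b E x).comp continuous_neg)
    (hV.comp (stronglyContinuous_freeEvolution b E))) x).const_smul (-I)

/-- The propagator in the interaction picture. -/
def interactionEvolution (hV : StronglyContinuous V) : ℝ → H →L[ℂ] H :=
  propagator (stronglyContinuous_interactionGenerator b E hV)

theorem interactionEvolution_zero (hV : StronglyContinuous V) (x : H) :
    interactionEvolution b E hV 0 x = x :=
  propagator_zero _ x

theorem hasDerivAt_interactionEvolution (hV : StronglyContinuous V) (x : H) (t : ℝ) :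
    HasDerivAt (fun s => interactionEvolution b E hV s x)
      (interactionGenerator b E V t (interactionEvolution b E hV t x)) t :=
  hasDerivAt_propagator _ x t

theorem stronglyContinuous_interactionEvolution (hV : StronglyContinuous V) :
    StronglyContinuous (interactionEvolution b E hV) :=
  stronglyContinuous_propagator _

theorem eq_interactionEvolution_of_weak_solution {κ : Type*} {w : κ → H}
    (hw : Dense (Submodule.span ℂ (Set.range w) : Set H)) (hV : StronglyContinuous V) {y : ℝ → H}
    (hy : LocallyBounded y)
    (hd : ∀ i t, HasDerivAt (fun s => inner ℂ (w i) (y s))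
      (inner ℂ (w i) (interactionGenerator b E V t (y t))) t) (t : ℝ) :
    y t = interactionEvolution b E hV t (y 0) :=
  eq_propagator_of_weak_solution hw _ hy hd t

/-- The propagator of `i ∂_t y = (H₀ + V(t)) y`. -/
def evolution (hV : StronglyContinuous V) (t : ℝ) : H →L[ℂ] H :=
  (freeEvolution b E t).comp (interactionEvolution b E hV t)

theorem evolution_apply (hV : StronglyContinuous V) (t : ℝ) (x : H) :
    evolution b E hV t x = freeEvolution b E t (interactionEvolution b E hV t x) := rfl

theorem evolution_zero (hV : StronglyContinuous V) (x : H) : evolution b E hV 0 x = x := by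
  rw [evolution_apply, freeEvolution_zero, interactionEvolution_zero]

theorem stronglyContinuous_evolution (hV : StronglyContinuous V) :
    StronglyContinuous (evolution b E hV) :=
  (stronglyContinuous_freeEvolution b E).comp (stronglyContinuous_interactionEvolution b E hV)

theorem hasDerivAt_inner_evolution (hV : StronglyContinuous V) {f h : H}
    (hfh : ∀ i, inner ℂ (b i) h = (E i : ℂ) * inner ℂ (b i) f) (x : H) (t : ℝ) :
    HasDerivAt (fun s => inner ℂ f (evolution b E hV s x))
      (-I * (inner ℂ h (evolution b E hV t x) + inner ℂ f (V t (evolution b E hV t x)))) t := by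
  simp only [evolution_apply]
  simp only [inner_freeEvolution_right b E _ f, inner_freeEvolution_right b E _ h]
  have hback : HasDerivAt (fun s => freeEvolution b E (-s) f)
      (-((-I) • freeEvolution b E (-t) h)) t := by
    simpa [Function.comp_def] using
      (hasDerivAt_freeEvolution b E hfh (-t)).scomp t (hasDerivAt_neg t)
  refine (hback.inner ℂ (hasDerivAt_interactionEvolution b E hV x t)).congr_deriv ?_
  rw [interactionGenerator_apply, inner_smul_right, inner_freeEvolution_right, neg_neg,
    freeEvolution_apply_neg, inner_neg_left, inner_smul_left]
  simp
  ring

theorem hasDerivAt_inner_basis_evolution (hV : StronglyContinuous V) (i : ι) (x : H) (t : ℝ) :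
    HasDerivAt (fun s => inner ℂ (b i) (evolution b E hV s x))
      (-I * ((E i : ℂ) * inner ℂ (b i) (evolution b E hV t x) +
        inner ℂ (b i) (V t (evolution b E hV t x)))) t := by
  have heigen : ∀ j, inner ℂ (b j) ((E i : ℂ) • b i) = (E j : ℂ) * inner ℂ (b j) (b i) := by
    intro j
    rw [inner_smul_right]
    by_cases hj : j = i
    · rw [hj]
    · rw [b.orthonormal.2 hj, mul_zero, mul_zero]
  simpa only [inner_smul_left, Complex.conj_ofReal] using
    hasDerivAt_inner_evolution b E hV heigen x t

theorem eq_evolution_of_weak_solution (hV : StronglyContinuous V) {y : ℝ → H}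
    (hy : LocallyBounded y)
    (hd : ∀ i t, HasDerivAt (fun s => inner ℂ (b i) (y s))
      (-I * ((E i : ℂ) * inner ℂ (b i) (y t) + inner ℂ (b i) (V t (y t)))) t) (t : ℝ) :
    y t = evolution b E hV t (y 0) := by
  have hbounded : LocallyBounded fun t => freeEvolution b E (-t) (y t) := fun T => by
    simpa only [norm_freeEvolution_apply] using hy T
  have hderiv : ∀ i t, HasDerivAt (fun s => inner ℂ (b i) (freeEvolution b E (-s) (y s)))
      (inner ℂ (b i) (interactionGenerator b E V t (freeEvolution b E (-t) (y t)))) t := by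
    intro i t
    have hphase : HasDerivAt (fun s : ℝ => -(I * ((-s : ℝ) : ℂ) * (E i : ℂ)))
        (-(I * (-1 : ℝ) * (E i : ℂ))) t :=
      (((hasDerivAt_neg t).ofReal_comp.const_mul I).mul_const _).fun_neg
    simp only [inner_freeEvolution]
    refine (hphase.cexp.mul (hd i t)).congr_deriv ?_
    rw [interactionGenerator_apply, inner_smul_right, inner_freeEvolution, freeEvolution_apply_neg]
    push_cast
    ring
  have h := eq_interactionEvolution_of_weak_solution b E (dense_span_range_hilbertBasis b) hV
    hbounded hderiv t
  rw [neg_zero, freeEvolution_zero] at h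
  rw [evolution_apply, ← h, freeEvolution_apply_neg]

end Evolution

/-! ## Square integrable functions -/

section LTwo

variable {X : Type*} [MeasurableSpace X] {μ : Measure X}

theorem inner_eq_integral (f g : Lp ℂ 2 μ) : inner ℂ f g = ∫ x, conj (f x) * g x ∂μ := by
  simp only [L2.inner_def, RCLike.inner_apply, mul_comm]

theorem inner_toLp_left {f : X → ℂ} (hf : MemLp f 2 μ) (g : Lp ℂ 2 μ) :
    inner ℂ (hf.toLp f) g = ∫ x, conj (f x) * g x ∂μ := by
  rw [inner_eq_integral]
  refine integral_congr_ae ?_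
  filter_upwards [hf.coeFn_toLp] with x hx
  rw [hx]

theorem inner_toLp_toLp {f g : X → ℂ} (hf : MemLp f 2 μ) (hg : MemLp g 2 μ) :
    inner ℂ (hf.toLp f) (hg.toLp g) = ∫ x, conj (f x) * g x ∂μ := by
  rw [inner_toLp_left]
  refine integral_congr_ae ?_
  filter_upwards [hg.coeFn_toLp] with x hx
  rw [hx]

/-- The operator of multiplication by an essentially bounded function. -/
def mulOp {g : X → ℂ} (hg : MemLp g ⊤ μ) : Lp ℂ 2 μ →L[ℂ] Lp ℂ 2 μ :=
  (ContinuousLinearMap.mul ℂ ℂ).holderL μ ⊤ 2 2 (hg.toLp g)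

theorem coeFn_mulOp {g : X → ℂ} (hg : MemLp g ⊤ μ) (f : Lp ℂ 2 μ) :
    mulOp hg f =ᵐ[μ] fun x => g x * f x := by
  have h := (ContinuousLinearMap.mul ℂ ℂ).coeFn_holder (r := 2) (hg.toLp g) f
  filter_upwards [h, hg.coeFn_toLp] with x hx hgx
  change (((ContinuousLinearMap.mul ℂ ℂ).holder 2 (hg.toLp g) f : Lp ℂ 2 μ)) x = _
  rw [hx, hgx]
  rfl

end LTwo

/-! ## Plane waves on an interval -/

/-- The plane wave of momentum `p`, normalised on intervals of length `ℓ`. -/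
def planeWave (ℓ p x : ℝ) : ℂ :=
  (((Real.sqrt ℓ)⁻¹ : ℝ) : ℂ) * Complex.exp (I * (p * x))

@[fun_prop]
theorem continuous_planeWave (ℓ p : ℝ) : Continuous (planeWave ℓ p) := by
  unfold planeWave; fun_prop

theorem contDiff_planeWave (ℓ p : ℝ) {k : WithTop ℕ∞} : ContDiff ℝ k (planeWave ℓ p) :=
  contDiff_const.mul
    (contDiff_const.mul (contDiff_const.mul Complex.ofRealCLM.contDiff)).cexp

theorem norm_planeWave (ℓ p x : ℝ) : ‖planeWave ℓ p x‖ = (Real.sqrt ℓ)⁻¹ := by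
  rw [planeWave, norm_mul, ← Complex.ofReal_mul, Complex.norm_exp_I_mul_ofReal, mul_one,
    Complex.norm_real]
  exact abs_of_nonneg (by positivity)

theorem memLp_planeWave (ℓ p : ℝ) (μ : Measure ℝ) [IsFiniteMeasure μ] :
    MemLp (planeWave ℓ p) 2 μ :=
  MemLp.of_bound (continuous_planeWave ℓ p).aestronglyMeasurable (Real.sqrt ℓ)⁻¹
    (Filter.Eventually.of_forall fun x => (norm_planeWave ℓ p x).le)

theorem conj_planeWave (ℓ p x : ℝ) : conj (planeWave ℓ p x) = planeWave ℓ (-p) x := by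
  simp [planeWave, ← Complex.exp_conj]

theorem planeWave_mul_planeWave (ℓ ℓ' p q x : ℝ) : planeWave ℓ p x * planeWave ℓ' q x =
    (((Real.sqrt ℓ)⁻¹ * (Real.sqrt ℓ')⁻¹ : ℝ) : ℂ) * Complex.exp (I * ((p + q : ℝ) * x)) := by
  rw [planeWave, planeWave, mul_mul_mul_comm, ← Complex.exp_add]
  push_cast
  ring_nf

theorem hasDerivAt_planeWave (ℓ p x : ℝ) :
    HasDerivAt (planeWave ℓ p) (I * p * planeWave ℓ p x) x := by
  have hphase : HasDerivAt (fun x : ℝ => I * (p * (x : ℂ))) (I * (p * 1)) x :=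
    ((hasDerivAt_id x).ofReal_comp.const_mul (p : ℂ)).const_mul I
  refine (hphase.cexp.const_mul _).congr_deriv ?_
  rw [planeWave]
  ring

theorem integral_exp_I_mul {p : ℝ} (hp : p ≠ 0) (a b : ℝ) :
    ∫ x in a..b, Complex.exp (I * (p * x)) =
      (Complex.exp (I * (p * b)) - Complex.exp (I * (p * a))) / (I * p) := by
  have hc : I * (p : ℂ) ≠ 0 := mul_ne_zero I_ne_zero (Complex.ofReal_ne_zero.mpr hp)
  simpa only [mul_assoc] using integral_exp_mul_complex (a := a) (b := b) hc

theorem integral_exp_period {ℓ : ℝ} (hℓ : 0 < ℓ) (a : ℝ) (k : ℤ) :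
    ∫ x in a..(a + ℓ), Complex.exp (I * ((2 * Real.pi * k / ℓ : ℝ) * x)) =
      if k = 0 then (ℓ : ℂ) else 0 := by
  have hℓ' : (ℓ : ℂ) ≠ 0 := Complex.ofReal_ne_zero.mpr hℓ.ne'
  split_ifs with hk
  · simp [hk]
  · have : (k : ℝ) ≠ 0 := Int.cast_ne_zero.mpr hk
    have hperiod : I * ((2 * Real.pi * k / ℓ : ℝ) * (a + ℓ : ℝ)) =
        I * ((2 * Real.pi * k / ℓ : ℝ) * a) + k * (2 * Real.pi * I) := by
      push_cast
      field_simp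
    rw [integral_exp_I_mul (by positivity), hperiod, Complex.exp_add,
      Complex.exp_int_mul_two_pi_mul_I, mul_one, sub_self, zero_div]

theorem integral_conj_planeWave_mul_planeWave {a b ℓ : ℝ} (hℓ : 0 < ℓ) (hab : b = a + ℓ) (θ : ℝ)
    (k m : ℤ) :
    ∫ x in Set.Ioc a b, conj (planeWave ℓ (θ + 2 * Real.pi * k / ℓ) x) *
      planeWave ℓ (θ + 2 * Real.pi * m / ℓ) x = if k = m then 1 else 0 := by
  have hfreq : -(θ + 2 * Real.pi * k / ℓ) + (θ + 2 * Real.pi * m / ℓ) =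
      2 * Real.pi * (m - k : ℤ) / ℓ := by
    push_cast
    ring
  simp only [conj_planeWave, planeWave_mul_planeWave, hfreq]
  rw [integral_const_mul, hab, ← intervalIntegral.integral_of_le (by linarith),
    integral_exp_period hℓ, ← mul_inv, Real.mul_self_sqrt hℓ.le]
  simp [sub_eq_zero, eq_comm (a := m), hℓ.ne']

theorem ae_eq_zero_of_fourierCoeffOn_eq_zero {a b : ℝ} (hab : a < b) {f : ℝ → ℂ}
    (hf : MemLp f 2 (volume.restrict (Set.Ioc a b))) (h : ∀ k, fourierCoeffOn hab f k = 0) :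
    f =ᵐ[volume.restrict (Set.Ioc a b)] 0 := by
  have hparseval := hasSum_sq_fourierCoeffOn hab hf
  simp only [h, norm_zero, ne_eq, OfNat.ofNat_ne_zero, not_false_eq_true, zero_pow] at hparseval
  have hzero := hparseval.unique hasSum_zero
  rw [smul_eq_zero, or_iff_right (inv_ne_zero (sub_ne_zero.mpr hab.ne')),
    intervalIntegral.integral_of_le hab.le,
    integral_eq_zero_iff_of_nonneg (fun x => by positivity)
      ((memLp_two_iff_integrable_sq_norm hf.1).mp hf)] at hzero
  filter_upwards [hzero] with x hx
  simpa using hx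

theorem ae_eq_zero_of_integral_conj_planeWave_mul {a b ℓ : ℝ} (hℓ : 0 < ℓ) (hab : b = a + ℓ)
    (θ : ℝ) {f : ℝ → ℂ} (hf : MemLp f 2 (volume.restrict (Set.Ioc a b)))
    (h : ∀ k : ℤ, ∫ x in Set.Ioc a b, conj (planeWave ℓ (θ + 2 * Real.pi * k / ℓ) x) * f x = 0) :
    f =ᵐ[volume.restrict (Set.Ioc a b)] 0 := by
  have hlt : a < b := by linarith
  obtain rfl : ℓ = b - a := by linarith
  have htwist : MemLp (fun x => planeWave 1 (-θ) x * f x) 2 (volume.restrict (Set.Ioc a b)) :=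
    hf.of_le_mul (c := 1) ((continuous_planeWave 1 (-θ)).aestronglyMeasurable.mul hf.1)
      (Filter.Eventually.of_forall fun x => by simp [norm_planeWave])
  have hcoeff : ∀ k, fourierCoeffOn hlt (fun x => planeWave 1 (-θ) x * f x) k = 0 := by
    intro k
    have hwave : ∀ x : ℝ, fourier (-k) (x : AddCircle (b - a)) • (planeWave 1 (-θ) x * f x) =
        (Real.sqrt (b - a) : ℂ) *
          (conj (planeWave (b - a) (θ + 2 * Real.pi * k / (b - a)) x) * f x) := by
      intro x
      have hsqrt : (Real.sqrt (b - a) : ℂ) ≠ 0 :=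
        Complex.ofReal_ne_zero.mpr (Real.sqrt_pos.mpr hℓ).ne'
      have hphase : Complex.exp (2 * Real.pi * I * (-k : ℤ) * x / (b - a : ℝ)) *
          Complex.exp (I * ((-θ : ℝ) * x)) =
            Complex.exp (I * ((-(θ + 2 * Real.pi * k / (b - a)) : ℝ) * x)) := by
        rw [← Complex.exp_add]
        push_cast
        ring_nf
      rw [fourier_coe_apply, smul_eq_mul, conj_planeWave, planeWave, planeWave, ← hphase,
        Real.sqrt_one, inv_one, Complex.ofReal_one, one_mul, Complex.ofReal_inv]
      field_simp
    rw [fourierCoeffOn_eq_integral, intervalIntegral.integral_of_le hlt.le]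
    simp only [hwave]
    rw [integral_const_mul, h k, mul_zero, smul_zero]
  filter_upwards [ae_eq_zero_of_fourierCoeffOn_eq_zero hlt htwist hcoeff] with x hx
  have hne : planeWave 1 (-θ) x ≠ 0 := norm_ne_zero_iff.mp (by simp [norm_planeWave])
  simpa [hne] using hx

/-! ## The one-particle space -/

/-- The Hilbert space of one particle on the ring. -/
abbrev RingSpace (L : ℝ) : Type := Lp ℂ 2 ((volume : Measure ℝ).restrict (Set.Ioc 0 L))

/-- The antiperiodic plane wave with the `m`-th momentum of `K`. -/
abbrev ringWave (L : ℝ) (m : ℤ) : ℝ → ℂ := planeWave L (ringMomentum L m)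

/-- The one-particle wavelet with a given label: a plane wave cut off outside its box. -/
def waveletFun (L : ℝ) {n : ℕ} (a : WaveletLabel n) : ℝ → ℂ :=
  (box L n a.2).indicator (planeWave (L / n) (momentum L a))

theorem ringMomentum_eq (L : ℝ) (m : ℤ) :
    ringMomentum L m = Real.pi / L + 2 * Real.pi * m / L := by
  rw [ringMomentum]
  ring

theorem momentum_eq (L : ℝ) {n : ℕ} (a : WaveletLabel n) :
    momentum L a = 0 + 2 * Real.pi * a.1 / (L / n) := by
  rw [momentum, div_div_eq_mul_div]
  ring

theorem measurableSet_box (L : ℝ) (n : ℕ) (b : Fin n) : MeasurableSet (box L n b) :=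
  measurableSet_Ioc

theorem memLp_waveletFun (L : ℝ) {n : ℕ} (a : WaveletLabel n) (μ : Measure ℝ)
    [IsFiniteMeasure μ] : MemLp (waveletFun L a) 2 μ :=
  (memLp_planeWave _ _ μ).indicator (measurableSet_box L n a.2)

theorem span_orthogonal_eq_bot {H ι : Type*} [NormedAddCommGroup H] [InnerProductSpace ℂ H]
    {v : ι → H} (h : ∀ f : H, (∀ i, inner ℂ (v i) f = 0) → f = 0) :
    (Submodule.span ℂ (Set.range v))ᗮ = ⊥ :=
  (Submodule.eq_bot_iff _).mpr fun f hf =>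
    h f fun i => (Submodule.mem_orthogonal _ _).mp hf _ (Submodule.subset_span ⟨i, rfl⟩)

section

variable {L : ℝ} (hL : 0 < L) {n : ℕ}

include hL

theorem orthonormal_ringWave :
    Orthonormal ℂ fun m : ℤ => ((memLp_planeWave L (ringMomentum L m) _).toLp _ : RingSpace L) := by
  refine orthonormal_iff_ite.mpr fun m k => ?_
  simp only [inner_toLp_toLp, ringMomentum_eq]
  exact integral_conj_planeWave_mul_planeWave hL (zero_add L).symm _ m k

theorem eq_zero_of_inner_ringWave (f : RingSpace L)
    (h : ∀ m, inner ℂ ((memLp_planeWave L (ringMomentum L m) _).toLp _ : RingSpace L) f = 0) :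
    f = 0 := by
  simp only [inner_toLp_left, ringMomentum_eq] at h
  exact Lp.eq_zero_iff_ae_eq_zero.mpr
    (ae_eq_zero_of_integral_conj_planeWave_mul hL (zero_add L).symm _ (Lp.memLp f) h)

/-- The Hilbert basis of antiperiodic plane waves. -/
def ringBasis : HilbertBasis ℤ ℂ (RingSpace L) :=
  HilbertBasis.mkOfOrthogonalEqBot (orthonormal_ringWave hL)
    (span_orthogonal_eq_bot (eq_zero_of_inner_ringWave hL))

theorem ringBasis_apply (m : ℤ) :
    ringBasis hL m = (memLp_planeWave L (ringMomentum L m) _).toLp _ := by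
  rw [ringBasis, HilbertBasis.coe_mkOfOrthogonalEqBot]

theorem box_subset (b : Fin n) : box L n b ⊆ Set.Ioc 0 L := by
  have hn : (0 : ℝ) < n := by exact_mod_cast b.pos
  have hb : ((b : ℝ) + 1) ≤ n := by exact_mod_cast b.isLt
  refine Set.Ioc_subset_Ioc (by positivity) ?_
  calc ((b : ℝ) + 1) * (L / n) ≤ n * (L / n) := by gcongr
    _ = L := by field_simp

theorem lt_of_mem_box {b c : Fin n} (hbc : b < c) {x y : ℝ}
    (hx : x ∈ box L n b) (hy : y ∈ box L n c) : x < y := by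
  have hb : ((b : ℝ) + 1) ≤ c := by exact_mod_cast hbc
  refine lt_of_le_of_lt (hx.2.trans ?_) hy.1
  gcongr

theorem eq_of_mem_box {b c : Fin n} {x : ℝ} (hx : x ∈ box L n b) (hy : x ∈ box L n c) : b = c := by
  rcases lt_trichotomy b c with h | h | h
  · exact absurd (lt_of_mem_box hL h hx hy) (lt_irrefl _)
  · exact h
  · exact absurd (lt_of_mem_box hL h hy hx) (lt_irrefl _)

theorem exists_mem_box (hn : 0 < n) {x : ℝ} (hx : x ∈ Set.Ioc 0 L) :
    ∃ b : Fin n, x ∈ box L n b := by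
  have hn' : (0 : ℝ) < n := by exact_mod_cast hn
  have hl : 0 < L / n := by positivity
  have hle : ⌈x / (L / n)⌉₊ ≤ n := by
    refine Nat.ceil_le.mpr ((div_le_iff₀ hl).mpr ?_)
    rw [mul_div_cancel₀ _ hn'.ne']
    exact hx.2
  obtain ⟨k, hk⟩ := Nat.exists_eq_succ_of_ne_zero (Nat.ceil_pos.mpr (div_pos hx.1 hl)).ne'
  have hlower : (k : ℝ) < x / (L / n) := Nat.lt_ceil.mp (by omega)
  have hupper : x / (L / n) ≤ (k : ℝ) + 1 := by exact_mod_cast hk ▸ Nat.le_ceil (x / (L / n))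
  exact ⟨⟨k, by omega⟩, (lt_div_iff₀ hl).mp hlower, (div_le_iff₀ hl).mp hupper⟩

theorem integral_mul_waveletFun (a : WaveletLabel n) (f : ℝ → ℂ) :
    ∫ x in Set.Ioc 0 L, conj (waveletFun L a x) * f x =
      ∫ x in box L n a.2, conj (planeWave (L / n) (momentum L a) x) * f x := by
  have hcut : ∀ x, conj (waveletFun L a x) * f x = (box L n a.2).indicator
      (fun x => conj (planeWave (L / n) (momentum L a) x) * f x) x := fun x => by
    by_cases hx : x ∈ box L n a.2 <;> simp [waveletFun, hx]
  simp only [hcut]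
  rw [setIntegral_indicator (measurableSet_box L n a.2),
    Set.inter_eq_right.mpr (box_subset hL a.2)]

theorem integral_conj_waveletFun_mul_waveletFun (a c : WaveletLabel n) :
    ∫ x in Set.Ioc 0 L, conj (waveletFun L a x) * waveletFun L c x = if a = c then 1 else 0 := by
  have hn : (0 : ℝ) < n := by exact_mod_cast a.2.pos
  rw [integral_mul_waveletFun hL]
  by_cases hb : a.2 = c.2
  · have hsame : ∀ x ∈ box L n a.2, conj (planeWave (L / n) (momentum L a) x) * waveletFun L c x =
        conj (planeWave (L / n) (momentum L a) x) * planeWave (L / n) (momentum L c) x :=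
      fun x hx => by rw [waveletFun, Set.indicator_of_mem (hb ▸ hx)]
    rw [setIntegral_congr_fun (measurableSet_box L n a.2) hsame, momentum_eq, momentum_eq, box,
      integral_conj_planeWave_mul_planeWave (by positivity) (by ring)]
    simp [Prod.ext_iff, hb]
  · have hdisjoint : ∀ x ∈ box L n a.2,
        conj (planeWave (L / n) (momentum L a) x) * waveletFun L c x = 0 := fun x hx => by
      rw [waveletFun, Set.indicator_of_notMem fun hx' => hb (eq_of_mem_box hL hx hx'), mul_zero]
    rw [setIntegral_congr_fun (measurableSet_box L n a.2) hdisjoint, integral_zero,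
      if_neg fun h => hb (congrArg Prod.snd h)]

theorem orthonormal_waveletFun :
    Orthonormal ℂ fun a : WaveletLabel n => ((memLp_waveletFun L a _).toLp _ : RingSpace L) :=
  orthonormal_iff_ite.mpr fun a c => by
    rw [inner_toLp_toLp, integral_conj_waveletFun_mul_waveletFun hL]

theorem eq_zero_of_inner_waveletFun (hn : 0 < n) (f : RingSpace L)
    (h : ∀ a : WaveletLabel n, inner ℂ ((memLp_waveletFun L a _).toLp _ : RingSpace L) f = 0) :
    f = 0 := by
  have : (0 : ℝ) < n := by exact_mod_cast hn
  simp only [inner_toLp_left, integral_mul_waveletFun hL, momentum_eq] at h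
  have hbox : ∀ b : Fin n, f =ᵐ[volume.restrict (box L n b)] 0 := fun b =>
    ae_eq_zero_of_integral_conj_planeWave_mul (by positivity : 0 < L / n) (by ring) 0
      ((Lp.memLp f).mono_measure (Measure.restrict_mono (box_subset hL b) le_rfl))
      fun k => h (k, b)
  have hall : ∀ᵐ x ∂(volume : Measure ℝ), ∀ b : Fin n, x ∈ box L n b → f x = 0 :=
    ae_all_iff.mpr fun b => (ae_restrict_iff' (measurableSet_box L n b)).mp (hbox b)
  refine Lp.eq_zero_iff_ae_eq_zero.mpr ((ae_restrict_iff' measurableSet_Ioc).mpr ?_)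
  filter_upwards [hall] with x hx hxL
  obtain ⟨b, hb⟩ := exists_mem_box hL hn hxL
  exact hx b hb

/-- The Hilbert basis of wavelets. -/
def waveletBasis (hn : 0 < n) : HilbertBasis (WaveletLabel n) ℂ (RingSpace L) :=
  HilbertBasis.mkOfOrthogonalEqBot (orthonormal_waveletFun hL)
    (span_orthogonal_eq_bot (eq_zero_of_inner_waveletFun hL hn))

theorem waveletBasis_apply (hn : 0 < n) (a : WaveletLabel n) :
    waveletBasis hL hn a = (memLp_waveletFun L a _).toLp _ := by
  rw [waveletBasis, HilbertBasis.coe_mkOfOrthogonalEqBot]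

theorem momentum_ne_ringMomentum (m : ℤ) (a : WaveletLabel n) :
    momentum L a ≠ ringMomentum L m := by
  intro h
  have hpi := Real.pi_pos
  have hreal : (n : ℝ) * a.1 = m + 1 / 2 := by
    rw [momentum, ringMomentum, div_left_inj' hL.ne', mul_assoc] at h
    exact mul_left_cancel₀ (by positivity) h
  have hint : 2 * (n * a.1) = 2 * m + 1 := by
    have : (2 * (n * a.1) : ℝ) = 2 * m + 1 := by linarith
    exact_mod_cast this
  omega

theorem exp_momentum_mul_box_edge (hn : 0 < n) (a : WaveletLabel n) (j : ℤ) :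
    Complex.exp (I * (momentum L a * (j * (L / n) : ℝ))) = 1 := by
  have hn' : (n : ℂ) ≠ 0 := by exact_mod_cast hn.ne'
  have hL' : (L : ℂ) ≠ 0 := by exact_mod_cast hL.ne'
  have hturns : I * (momentum L a * (j * (L / n) : ℝ)) =
      ((a.1 * j : ℤ) : ℂ) * (2 * Real.pi * I) := by
    simp only [momentum]
    push_cast
    field_simp
  rw [hturns, Complex.exp_int_mul_two_pi_mul_I]

theorem inv_sqrt_mul_inv_sqrt_div (n : ℕ) :
    (Real.sqrt L)⁻¹ * (Real.sqrt (L / n))⁻¹ = Real.sqrt n / L := by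
  rw [Real.sqrt_div hL.le, inv_div, ← mul_div_assoc, inv_mul_eq_div, div_div,
    Real.mul_self_sqrt hL.le]

theorem integral_conj_ringWave_mul_waveletFun (m : ℤ) (a : WaveletLabel n) :
    ∫ x in Set.Ioc 0 L, conj (ringWave L m x) * waveletFun L a x =
      (Real.sqrt n / L : ℝ) * ∫ x in (a.2 * (L / n) : ℝ)..((a.2 + 1) * (L / n) : ℝ),
        Complex.exp (I * ((momentum L a - ringMomentum L m : ℝ) * x)) := by
  have hcut : ∀ x, conj (ringWave L m x) * waveletFun L a x = (box L n a.2).indicator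
      (fun x => (Real.sqrt n / L : ℝ) *
        Complex.exp (I * ((momentum L a - ringMomentum L m : ℝ) * x))) x := fun x => by
    by_cases hx : x ∈ box L n a.2
    · rw [waveletFun, Set.indicator_of_mem hx, Set.indicator_of_mem hx, conj_planeWave,
        planeWave_mul_planeWave, inv_sqrt_mul_inv_sqrt_div hL, neg_add_eq_sub]
    · simp [waveletFun, hx]
  have hl : 0 ≤ L / n := by positivity
  simp only [hcut]
  rw [setIntegral_indicator (measurableSet_box L n a.2),
    Set.inter_eq_right.mpr (box_subset hL a.2), integral_const_mul, box,
    intervalIntegral.integral_of_le (by linarith)]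

theorem inner_ringBasis_waveletBasis (hn : 0 < n) (m : ℤ) (a : WaveletLabel n) :
    inner ℂ (ringBasis hL m) (waveletBasis hL hn a) = overlap L (ringMomentum L m) a := by
  have hsub : momentum L a - ringMomentum L m ≠ 0 :=
    sub_ne_zero.mpr (momentum_ne_ringMomentum hL m a)
  have hphase : ∀ j : ℤ, Complex.exp (I * ((momentum L a - ringMomentum L m : ℝ) *
      (j * (L / n) : ℝ))) = Complex.exp (-(I * L * j / n * ringMomentum L m)) := fun j => by
    have hsplit : I * ((momentum L a - ringMomentum L m : ℝ) * (j * (L / n) : ℝ)) =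
        I * (momentum L a * (j * (L / n) : ℝ)) + -(I * L * j / n * ringMomentum L m) := by
      push_cast
      ring
    rw [hsplit, Complex.exp_add, exp_momentum_mul_box_edge hL hn, one_mul]
  have hleft := hphase a.2
  have hright := hphase (a.2 + 1)
  have hedges : Complex.exp (-(I * L * a.2 / n * ringMomentum L m)) =
      Complex.exp (I * L * ringMomentum L m / n) *
        Complex.exp (-(I * L * (a.2 + 1) / n * ringMomentum L m)) := by
    rw [← Complex.exp_add]
    ring_nf
  push_cast at hleft hright
  rw [ringBasis_apply, waveletBasis_apply, inner_toLp_toLp,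
    integral_conj_ringWave_mul_waveletFun hL, integral_exp_I_mul hsub]
  push_cast
  rw [hleft, hright, hedges, overlap, ← neg_sub (ringMomentum L m : ℂ), mul_neg, div_neg]
  have hsub' : (ringMomentum L m : ℂ) - momentum L a ≠ 0 := by
    exact_mod_cast sub_ne_zero.mpr (momentum_ne_ringMomentum hL m a).symm
  field_simp
  linear_combination (√n * Complex.exp (L * I * ringMomentum L m / n) / L - √n / L) * I_sq

end

/-! ## The one-particle evolution -/

section HilbertBasis

variable {H κ : Type*} [NormedAddCommGroup H] [InnerProductSpace ℂ H] (w : HilbertBasis κ ℂ H)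

theorem hasSum_inner_clm (T : H →L[ℂ] H) (x y : H) :
    HasSum (fun k => inner ℂ x (T (w k)) * inner ℂ (w k) y) (inner ℂ x (T y)) := by
  refine (((w.hasSum_repr y).mapL T).mapL (innerSL ℂ x)).congr_fun fun k => ?_
  rw [map_smul, innerSL_apply_apply, inner_smul_right, w.repr_apply_apply, mul_comm]

theorem hasSum_norm_inner_sq (y : H) : HasSum (fun k => ‖inner ℂ (w k) y‖ ^ 2) (‖y‖ ^ 2) := by
  have hnorm := lp.hasSum_norm (p := 2) (by norm_num) (w.repr y)
  simpa [w.repr_apply_apply] using hnorm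

theorem exists_forall_inner_eq (f : κ → ℂ) (hf : Summable fun k => ‖f k‖ ^ 2) :
    ∃ y : H, ∀ k, inner ℂ (w k) y = f k := by
  have hmem : Memℓp f 2 := (memℓp_gen_iff (by simp)).mpr (by simpa using hf)
  refine ⟨w.repr.symm ⟨f, hmem⟩, fun k => ?_⟩
  rw [← w.repr_apply_apply, LinearIsometryEquiv.apply_symm_apply]

end HilbertBasis

theorem memLp_top_boxIndicator (L : ℝ) {n : ℕ} (b : Fin n) (μ : Measure ℝ) :
    MemLp ((box L n b).indicator fun _ => (1 : ℂ)) ⊤ μ :=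
  memLp_top_of_bound
    (measurable_const.indicator (measurableSet_box L n b)).aestronglyMeasurable 1
    (Filter.Eventually.of_forall fun x => by by_cases hx : x ∈ box L n b <;> simp [hx])

/-- The orthogonal projection to the one-particle wave functions supported in a box. -/
def boxProj (L : ℝ) {n : ℕ} (b : Fin n) : RingSpace L →L[ℂ] RingSpace L :=
  mulOp (memLp_top_boxIndicator L b _)

/-- The one-particle potential energy operator. -/
def ringPotential (L : ℝ) {n : ℕ} (v : Fin n → ℝ → ℝ) (t : ℝ) : RingSpace L →L[ℂ] RingSpace L :=
  ∑ b, (v b t : ℂ) • boxProj L b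

theorem stronglyContinuous_ringPotential (L : ℝ) {n : ℕ} {v : Fin n → ℝ → ℝ}
    (hv : ∀ b, Continuous (v b)) : StronglyContinuous (ringPotential L v) :=
  .of_continuous <| continuous_finsetSum _ fun b _ =>
    (Complex.continuous_ofReal.comp (hv b)).smul continuous_const

/-- The kinetic energy of a plane wave. -/
def ringEnergy (L : ℝ) (m : ℤ) : ℝ := ringMomentum L m ^ 2

/-- The free one-particle evolution. -/
abbrev ringFree {L : ℝ} (hL : 0 < L) (t : ℝ) : RingSpace L →L[ℂ] RingSpace L :=
  freeEvolution (ringBasis hL) (ringEnergy L) t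

section

variable {L : ℝ} (hL : 0 < L) {n : ℕ} (hn : 0 < n)

theorem inner_waveletBasis_boxProj (a : WaveletLabel n) (b : Fin n) (x : RingSpace L) :
    inner ℂ (waveletBasis hL hn a) (boxProj L b x) =
      if a.2 = b then inner ℂ (waveletBasis hL hn a) x else 0 := by
  have hcut : (fun y => conj (waveletFun L a y) * (boxProj L b x) y)
      =ᵐ[(volume : Measure ℝ).restrict (Set.Ioc 0 L)]
      fun y => if a.2 = b then conj (waveletFun L a y) * x y else 0 := by
    filter_upwards [coeFn_mulOp (memLp_top_boxIndicator L b _) x] with y hy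
    rw [boxProj, hy]
    by_cases hya : y ∈ box L n a.2
    · split_ifs with hab
      · rw [Set.indicator_of_mem (hab ▸ hya), one_mul]
      · rw [Set.indicator_of_notMem fun hyb => hab (eq_of_mem_box hL hya hyb), zero_mul, mul_zero]
    · simp [waveletFun, hya]
  rw [waveletBasis_apply, inner_toLp_left, inner_toLp_left, integral_congr_ae hcut]
  split_ifs <;> simp

theorem inner_waveletBasis_ringPotential (v : Fin n → ℝ → ℝ) (t : ℝ) (a : WaveletLabel n)
    (x : RingSpace L) :
    inner ℂ (waveletBasis hL hn a) (ringPotential L v t x) =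
      (v a.2 t : ℂ) * inner ℂ (waveletBasis hL hn a) x := by
  simp only [ringPotential, sum_apply, smul_apply, inner_sum, inner_smul_right,
    inner_waveletBasis_boxProj]
  simp

theorem hasSum_greenTerm (t : ℝ) (a c : WaveletLabel n) :
    HasSum (greenTerm L t a c)
      (inner ℂ (waveletBasis hL hn a) (ringFree hL t (waveletBasis hL hn c))) := by
  refine ((ringBasis hL).hasSum_inner_mul_inner (waveletBasis hL hn a)
    (ringFree hL t (waveletBasis hL hn c))).congr_fun fun m => ?_
  rw [inner_freeEvolution, inner_ringBasis_waveletBasis, ← inner_conj_symm,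
    inner_ringBasis_waveletBasis, greenTerm, ringEnergy]
  push_cast
  ring

theorem green_eq_inner (t : ℝ) (a c : WaveletLabel n) :
    green L t a c = inner ℂ (waveletBasis hL hn a) (ringFree hL t (waveletBasis hL hn c)) :=
  (hasSum_greenTerm hL hn t a c).tsum_eq

theorem hasSum_generator (v : Fin n → ℝ → ℝ) (t : ℝ) (a c : WaveletLabel n) :
    HasSum (fun g : WaveletLabel n => green L (-t) a g * (v g.2 t : ℂ) * green L t g c)
      (inner ℂ (waveletBasis hL hn a)
        (ringFree hL (-t) (ringPotential L v t (ringFree hL t (waveletBasis hL hn c))))) := by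
  refine (hasSum_inner_clm (waveletBasis hL hn) (ringFree hL (-t)) (waveletBasis hL hn a)
    (ringPotential L v t (ringFree hL t (waveletBasis hL hn c)))).congr_fun fun g => ?_
  rw [inner_waveletBasis_ringPotential, green_eq_inner hL hn, green_eq_inner hL hn, mul_assoc]

theorem hasSum_generator_mul (v : Fin n → ℝ → ℝ) (t : ℝ) (a : WaveletLabel n) (y : RingSpace L) :
    HasSum (fun k : WaveletLabel n => generator L v t a k * inner ℂ (waveletBasis hL hn k) y)
      (inner ℂ (waveletBasis hL hn a)
        (ringFree hL (-t) (ringPotential L v t (ringFree hL t y)))) := by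
  simp only [generator, (hasSum_generator hL hn v t a _).tsum_eq]
  exact hasSum_inner_clm (waveletBasis hL hn)
    (ringFree hL (-t) ∘L ringPotential L v t ∘L ringFree hL t) (waveletBasis hL hn a) y

theorem tsum_generator_mul (v : Fin n → ℝ → ℝ) (t : ℝ) (a : WaveletLabel n) (y : RingSpace L) :
    -I * ∑' k, generator L v t a k * inner ℂ (waveletBasis hL hn k) y =
      inner ℂ (waveletBasis hL hn a)
        (interactionGenerator (ringBasis hL) (ringEnergy L) (ringPotential L v) t y) := by
  rw [(hasSum_generator_mul hL hn v t a y).tsum_eq, interactionGenerator_apply, inner_smul_right]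

variable {v : Fin n → ℝ → ℝ} (hv : ∀ b, Continuous (v b))

/-- The one-particle evolution in the interaction picture. -/
abbrev ringInteraction (t : ℝ) : RingSpace L →L[ℂ] RingSpace L :=
  interactionEvolution (ringBasis hL) (ringEnergy L) (stronglyContinuous_ringPotential L hv) t

/-- The one-particle evolution. -/
abbrev ringEvolution (t : ℝ) : RingSpace L →L[ℂ] RingSpace L :=
  evolution (ringBasis hL) (ringEnergy L) (stronglyContinuous_ringPotential L hv) t

/-- The matrix of the one-particle evolution in the interaction picture, in the wavelet basis; this
is the function `ψ̃`. -/
def interactionMatrix (t : ℝ) (a c : WaveletLabel n) : ℂ :=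
  inner ℂ (waveletBasis hL hn a) (ringInteraction hL hv t (waveletBasis hL hn c))

theorem isInteractionSolution_interactionMatrix :
    IsInteractionSolution L v (interactionMatrix hL hn hv) where
  initial a c := by
    rw [interactionMatrix, interactionEvolution_zero]
    exact orthonormal_iff_ite.mp (waveletBasis hL hn).orthonormal a c
  bounded T c := by
    obtain ⟨M, hM⟩ := locallyBounded_of_continuous (stronglyContinuous_interactionEvolution
      (ringBasis hL) (ringEnergy L) (stronglyContinuous_ringPotential L hv)
      (waveletBasis hL hn c)) T
    refine ⟨M ^ 2, fun t ht => ?_⟩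
    have hsum := hasSum_norm_inner_sq (waveletBasis hL hn)
      (ringInteraction hL hv t (waveletBasis hL hn c))
    exact ⟨hsum.summable, hsum.tsum_eq.trans_le (by gcongr; exact hM t ht)⟩
  deriv t a c := by
    unfold interactionMatrix
    rw [tsum_generator_mul]
    exact hasDerivAt_inner_const_left _ (hasDerivAt_interactionEvolution _ _ _ _ t)

theorem eq_interactionMatrix {ψ : ℝ → WaveletLabel n → WaveletLabel n → ℂ}
    (hψ : IsInteractionSolution L v ψ) : ψ = interactionMatrix hL hn hv := by
  have hcolumn : ∀ c t, ∃ y : RingSpace L, ∀ a, inner ℂ (waveletBasis hL hn a) y = ψ t a c :=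
    fun c t => exists_forall_inner_eq _ _ <|
      let ⟨_, hC⟩ := hψ.bounded |t| c
      (hC t le_rfl).1
  choose y hy using hcolumn
  have hbounded : ∀ c, LocallyBounded (y c) := fun c T => by
    obtain ⟨C, hC⟩ := hψ.bounded T c
    refine ⟨Real.sqrt C, fun t ht => Real.le_sqrt_of_sq_le ?_⟩
    rw [← (hasSum_norm_inner_sq (waveletBasis hL hn) (y c t)).tsum_eq]
    simpa only [hy] using (hC t ht).2
  have hevolution : ∀ c t, y c t = ringInteraction hL hv t (y c 0) := fun c =>
    eq_interactionEvolution_of_weak_solution _ _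
      (dense_span_range_hilbertBasis (waveletBasis hL hn)) _ (hbounded c) fun a t => by
        rw [← tsum_generator_mul]
        simpa only [hy] using hψ.deriv t a c
  have hinitial : ∀ c, y c 0 = waveletBasis hL hn c := fun c =>
    eq_of_forall_inner_eq (dense_span_range_hilbertBasis (waveletBasis hL hn)) fun a => by
      rw [hy, hψ.initial]
      exact (orthonormal_iff_ite.mp (waveletBasis hL hn).orthonormal a c).symm
  funext t a c
  rw [← hy, hevolution, hinitial, interactionMatrix]

theorem summable_generator_mul (t : ℝ) (a c : WaveletLabel n) :
    Summable fun k => generator L v t a k * interactionMatrix hL hn hv t k c :=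
  (hasSum_generator_mul hL hn v t a _).summable

theorem hasSum_psi (t : ℝ) (a c : WaveletLabel n) :
    HasSum (fun g => green L t a g * interactionMatrix hL hn hv t g c)
      (inner ℂ (waveletBasis hL hn a) (ringEvolution hL hv t (waveletBasis hL hn c))) := by
  simp only [green_eq_inner hL hn]
  exact hasSum_inner_clm (waveletBasis hL hn) (ringFree hL t) (waveletBasis hL hn a)
    (ringInteraction hL hv t (waveletBasis hL hn c))

theorem psi_interactionMatrix (t : ℝ) (a c : WaveletLabel n) :
    psi L (interactionMatrix hL hn hv) t a c =
      inner ℂ (waveletBasis hL hn a) (ringEvolution hL hv t (waveletBasis hL hn c)) :=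
  (hasSum_psi hL hn hv t a c).tsum_eq

end

/-! ## Tensor products of wave functions -/

theorem multilinear_ext_of_dense_span {R ι F : Type*} {E κ : ι → Type*} [Finite ι] [Semiring R]
    [∀ i, AddCommMonoid (E i)] [∀ i, Module R (E i)] [∀ i, TopologicalSpace (E i)]
    [AddCommMonoid F] [Module R F] [TopologicalSpace F] [T2Space F] {w : ∀ i, κ i → E i}
    (hw : ∀ i, Dense (Submodule.span R (Set.range (w i)) : Set (E i)))
    {S T : ContinuousMultilinearMap R E F}
    (h : ∀ k : ∀ i, κ i, S (fun i => w i (k i)) = T fun i => w i (k i)) : S = T := by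
  classical
  cases nonempty_fintype ι
  suffices key : ∀ (s : Finset ι) (ψ : ∀ i, E i),
      (∀ i ∉ s, ψ i ∈ Set.range (w i)) → S ψ = T ψ from
    ContinuousMultilinearMap.ext fun ψ => key Finset.univ ψ (by simp)
  intro s
  induction s using Finset.induction with
  | empty =>
    intro ψ hψ
    choose k hk using fun i => hψ i (Finset.notMem_empty i)
    rw [← funext hk]
    exact h k
  | insert j s hj ih =>
    intro ψ hψ
    have hcoord : S.toContinuousLinearMap ψ j = T.toContinuousLinearMap ψ j := by
      refine ContinuousLinearMap.ext_on (hw j) fun φ hφ => ih _ fun i hi => ?_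
      obtain rfl | hij := eq_or_ne i j
      · simpa using hφ
      · rw [Function.update_of_ne hij]
        exact hψ i (by simp [hij, hi])
    simpa using DFunLike.congr_fun hcoord (ψ j)

section Tensor

variable {X : Type*} [MeasurableSpace X] {μ : Measure X} {ι : Type*} [Fintype ι]

section

variable [SigmaFinite μ]

theorem ae_forall_eval {p : ι → X → Prop} (h : ∀ i, ∀ᵐ y ∂μ, p i y) :
    ∀ᵐ x ∂(Measure.pi fun _ : ι => μ), ∀ i, p i (x i) :=
  ae_all_iff.mpr fun i => (Measure.quasiMeasurePreserving_eval _ i).ae (h i)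

theorem memLp_two_prod {f : ι → X → ℂ} (hf : ∀ i, MemLp (f i) 2 μ) :
    MemLp (fun x : ι → X => ∏ i, f i (x i)) 2 (Measure.pi fun _ => μ) := by
  have hm : AEStronglyMeasurable (fun x : ι → X => ∏ i, f i (x i)) (Measure.pi fun _ => μ) :=
    Finset.aestronglyMeasurable_fun_prod _ fun i _ =>
      (hf i).1.comp_quasiMeasurePreserving (Measure.quasiMeasurePreserving_eval _ i)
  rw [memLp_two_iff_integrable_sq_norm hm]
  simp only [norm_prod, ← Finset.prod_pow]
  exact Integrable.fintype_prod (f := fun i y => ‖f i y‖ ^ 2)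
    fun i => (memLp_two_iff_integrable_sq_norm (hf i).1).mp (hf i)

/-- The wave function `x ↦ ∏ i, ψ i (x i)`: the values of the continuous multilinear map
`tensor`. -/
def tensorFun (ψ : ι → Lp ℂ 2 μ) : Lp ℂ 2 (Measure.pi fun _ : ι => μ) :=
  (memLp_two_prod fun i => Lp.memLp (ψ i)).toLp _

theorem coeFn_tensorFun (ψ : ι → Lp ℂ 2 μ) :
    tensorFun ψ =ᵐ[Measure.pi fun _ => μ] fun x => ∏ i, ψ i (x i) :=
  MemLp.coeFn_toLp _

theorem inner_tensorFun (φ ψ : ι → Lp ℂ 2 μ) :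
    inner ℂ (tensorFun φ) (tensorFun ψ) = ∏ i, inner ℂ (φ i) (ψ i) := by
  rw [tensorFun, tensorFun, inner_toLp_toLp]
  simp only [inner_eq_integral, map_prod, ← Finset.prod_mul_distrib]
  exact integral_fintype_prod_eq_prod (fun i y => conj (φ i y) * ψ i y)

theorem norm_tensorFun (ψ : ι → Lp ℂ 2 μ) : ‖tensorFun ψ‖ = ∏ i, ‖ψ i‖ := by
  refine (sq_eq_sq₀ (norm_nonneg _) (by positivity)).mp ?_
  have hinner := inner_tensorFun ψ ψ
  simp only [inner_self_eq_norm_sq_to_K, Finset.prod_pow] at hinner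
  exact_mod_cast hinner

variable [DecidableEq ι]

theorem coeFn_tensorFun_update (ψ : ι → Lp ℂ 2 μ) (i : ι) (φ : Lp ℂ 2 μ) :
    tensorFun (Function.update ψ i φ) =ᵐ[Measure.pi fun _ => μ]
      fun x => ∏ j, Function.update (fun j => ψ j (x j)) i (φ (x i)) j := by
  filter_upwards [coeFn_tensorFun (Function.update ψ i φ)] with x hx
  rw [hx]
  refine Finset.prod_congr rfl fun j _ => ?_
  obtain rfl | hij := eq_or_ne j i
  · simp
  · simp [hij]

theorem tensorFun_update_add (ψ : ι → Lp ℂ 2 μ) (i : ι) (φ χ : Lp ℂ 2 μ) :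
    tensorFun (Function.update ψ i (φ + χ)) =
      tensorFun (Function.update ψ i φ) + tensorFun (Function.update ψ i χ) := by
  refine Lp.ext ?_
  filter_upwards [coeFn_tensorFun_update ψ i (φ + χ), coeFn_tensorFun_update ψ i φ,
    coeFn_tensorFun_update ψ i χ, Lp.coeFn_add (tensorFun (Function.update ψ i φ))
      (tensorFun (Function.update ψ i χ)),
    (Measure.quasiMeasurePreserving_eval _ i).ae (Lp.coeFn_add φ χ)] with x hφχ hφ hχ hadd hval
  rw [hadd, Pi.add_apply, hφχ, hφ, hχ]
  simp only [Function.eval, Pi.add_apply] at hval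
  rw [hval]
  exact (MultilinearMap.mkPiAlgebra ℂ ι ℂ).map_update_add _ i _ _

theorem tensorFun_update_smul (ψ : ι → Lp ℂ 2 μ) (i : ι) (c : ℂ) (φ : Lp ℂ 2 μ) :
    tensorFun (Function.update ψ i (c • φ)) = c • tensorFun (Function.update ψ i φ) := by
  refine Lp.ext ?_
  filter_upwards [coeFn_tensorFun_update ψ i (c • φ), coeFn_tensorFun_update ψ i φ,
    Lp.coeFn_smul c (tensorFun (Function.update ψ i φ)),
    (Measure.quasiMeasurePreserving_eval _ i).ae (Lp.coeFn_smul c φ)] with x hcφ hφ hsmul hval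
  rw [hsmul, Pi.smul_apply, hcφ, hφ]
  simp only [Function.eval, Pi.smul_apply] at hval
  rw [hval]
  exact (MultilinearMap.mkPiAlgebra ℂ ι ℂ).map_update_smul _ i _ _

end

variable (μ ι) in
/-- The tensor product of a finite family of wave functions in `L²(μ)`, as a continuous multilinear
map to `L²` of the product measure. -/
def tensor [SigmaFinite μ] :
    ContinuousMultilinearMap ℂ (fun _ : ι => Lp ℂ 2 μ) (Lp ℂ 2 (Measure.pi fun _ : ι => μ)) :=
  MultilinearMap.mkContinuous
    { toFun := tensorFun
      map_update_add' := tensorFun_update_add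
      map_update_smul' := tensorFun_update_smul } 1
    fun ψ => by rw [one_mul]; exact (norm_tensorFun ψ).le

section

variable [SigmaFinite μ]

theorem coeFn_tensor (ψ : ι → Lp ℂ 2 μ) :
    tensor μ ι ψ =ᵐ[Measure.pi fun _ => μ] fun x => ∏ i, ψ i (x i) :=
  coeFn_tensorFun ψ

theorem tensor_toLp {f : ι → X → ℂ} (hf : ∀ i, MemLp (f i) 2 μ) :
    tensor μ ι (fun i => (hf i).toLp (f i)) = (memLp_two_prod hf).toLp _ := by
  refine Lp.ext ?_
  filter_upwards [coeFn_tensor fun i => (hf i).toLp (f i), (memLp_two_prod hf).coeFn_toLp,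
    ae_forall_eval fun i => (hf i).coeFn_toLp] with x htensor hprod hval
  rw [htensor, hprod]
  exact Finset.prod_congr rfl fun i _ => hval i

theorem inner_tensor (φ ψ : ι → Lp ℂ 2 μ) :
    inner ℂ (tensor μ ι φ) (tensor μ ι ψ) = ∏ i, inner ℂ (φ i) (ψ i) :=
  inner_tensorFun φ ψ

theorem mulOp_sum_tensor [DecidableEq ι] {g : X → ℂ} (hg : MemLp g ⊤ μ)
    (hG : MemLp (fun x : ι → X => ∑ i, g (x i)) ⊤ (Measure.pi fun _ => μ)) (ψ : ι → Lp ℂ 2 μ) :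
    mulOp hG (tensor μ ι ψ) = ∑ i, tensor μ ι (Function.update ψ i (mulOp hg (ψ i))) := by
  refine Lp.ext ?_
  have hupdate := ae_all_iff.mpr fun i => coeFn_tensorFun_update ψ i (mulOp hg (ψ i))
  filter_upwards [coeFn_mulOp hG (tensor μ ι ψ), hupdate, coeFn_tensor ψ,
    Lp.coeFn_finsetSum Finset.univ fun i => tensor μ ι (Function.update ψ i (mulOp hg (ψ i))),
    ae_forall_eval fun i => coeFn_mulOp hg (ψ i)] with x hGx hup htensor hsum hgx
  rw [hGx, hsum, Finset.sum_apply, htensor, Finset.sum_mul]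
  refine Finset.sum_congr rfl fun i _ => ?_
  refine Eq.trans ?_ (hup i).symm
  rw [hgx i, Finset.prod_update_of_mem (Finset.mem_univ i), mul_assoc,
    Finset.sdiff_singleton_eq_erase,
    Finset.mul_prod_erase Finset.univ (fun j => ψ j (x j)) (Finset.mem_univ i)]

theorem orthonormal_tensor {κ : Type*} {b : κ → Lp ℂ 2 μ} (hb : Orthonormal ℂ b) :
    Orthonormal ℂ fun k : ι → κ => tensor μ ι fun i => b (k i) := by
  classical
  rw [orthonormal_iff_ite]
  intro k l
  simp only [inner_tensor, orthonormal_iff_ite.mp hb, Finset.prod_ite_zero, Finset.prod_const_one,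
    Finset.mem_univ, true_implies, funext_iff]

end

variable [IsFiniteMeasure μ]

theorem ae_eq_zero_of_forall_setIntegral_pi {f : (ι → X) → ℂ}
    (hf : Integrable f (Measure.pi fun _ => μ))
    (h : ∀ t : ι → Set X, (∀ i, MeasurableSet (t i)) →
      ∫ x in Set.univ.pi t, f x ∂(Measure.pi fun _ => μ) = 0) :
    f =ᵐ[Measure.pi fun _ => μ] 0 := by
  refine hf.ae_eq_zero_of_forall_setIntegral_eq_zero fun s hs _ => ?_
  have huniv : ∫ x, f x ∂(Measure.pi fun _ => μ) = 0 := by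
    simpa using h (fun _ => Set.univ) fun _ => MeasurableSet.univ
  induction s, hs using MeasurableSpace.induction_on_inter
    (generateFrom_pi (ι := ι) (α := fun _ => X)).symm isPiSystem_pi with
  | empty => simp
  | basic s hs =>
    obtain ⟨t, ht, rfl⟩ := hs
    exact h t fun i => ht i trivial
  | compl s hs hzero =>
    have hadd := integral_add_compl hs hf
    rwa [hzero (measure_lt_top _ _), huniv, zero_add] at hadd
  | iUnion s hdisj hs hzero =>
    rw [integral_iUnion hs hdisj hf.integrableOn]
    simp [hzero]

theorem eq_zero_of_forall_inner_tensor {f : Lp ℂ 2 (Measure.pi fun _ : ι => μ)}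
    (h : ∀ ψ, inner ℂ (tensor μ ι ψ) f = 0) : f = 0 := by
  refine Lp.eq_zero_iff_ae_eq_zero.mpr (ae_eq_zero_of_forall_setIntegral_pi
    ((Lp.memLp f).integrable (by norm_num)) fun t ht => ?_)
  have hmem : ∀ i, MemLp ((t i).indicator (1 : X → ℂ)) 2 μ := fun i =>
    (memLp_const (1 : ℂ)).indicator (ht i)
  rw [← h fun i => (hmem i).toLp _, tensor_toLp, inner_toLp_left,
    ← integral_indicator (MeasurableSet.univ_pi ht)]
  congr 1 with x
  rw [← Set.indicator_pi_one_apply, Finset.coe_univ]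
  by_cases hx : x ∈ Set.univ.pi t <;> simp only [Set.indicator_of_mem,
    Set.indicator_of_notMem, hx, not_false_eq_true, Pi.one_apply, map_one, map_zero, one_mul,
    zero_mul]

/-- The Hilbert basis of the tensor products of the elements of a Hilbert basis of `L²(μ)`. -/
def tensorBasis (ι : Type*) [Fintype ι] {κ : Type*} (b : HilbertBasis κ ℂ (Lp ℂ 2 μ)) :
    HilbertBasis (ι → κ) ℂ (Lp ℂ 2 (Measure.pi fun _ : ι => μ)) :=
  HilbertBasis.mkOfOrthogonalEqBot (orthonormal_tensor b.orthonormal)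
    (span_orthogonal_eq_bot fun f hf => eq_zero_of_forall_inner_tensor fun ψ => by
      rw [← inner_conj_symm]
      have hzero : (innerSL ℂ f).compContinuousMultilinearMap (tensor μ ι) = 0 :=
        multilinear_ext_of_dense_span (fun _ => dense_span_range_hilbertBasis b) fun k =>
          inner_eq_zero_symm.mp (hf k)
      exact (congrArg conj (DFunLike.congr_fun hzero ψ)).trans (map_zero _))

theorem tensorBasis_apply {κ : Type*} (b : HilbertBasis κ ℂ (Lp ℂ 2 μ)) (k : ι → κ) :
    tensorBasis ι b k = tensor μ ι fun i => b (k i) := by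
  rw [tensorBasis, HilbertBasis.coe_mkOfOrthogonalEqBot]

theorem hasDerivAt_prod_of_energy_add [DecidableEq ι] {u : ι → ℝ → ℂ} {E w : ι → ℂ} {t : ℝ}
    (h : ∀ i, HasDerivAt (u i) (-I * (E i * u i t + w i)) t) :
    HasDerivAt (fun s => ∏ i, u i s)
      (-I * ((∑ i, E i) * ∏ i, u i t +
        ∑ i, ∏ j, Function.update (fun j => u j t) i (w i) j)) t := by
  refine (HasDerivAt.fun_finsetProd fun i _ => h i).congr_deriv ?_
  rw [Finset.sum_mul, ← Finset.sum_add_distrib, Finset.mul_sum]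
  refine Finset.sum_congr rfl fun i _ => ?_
  rw [Finset.prod_update_of_mem (Finset.mem_univ i), Finset.sdiff_singleton_eq_erase,
    ← Finset.mul_prod_erase _ _ (Finset.mem_univ i), smul_eq_mul]
  ring

theorem evolution_tensor [DecidableEq ι] {κ : Type*} (b : HilbertBasis κ ℂ (Lp ℂ 2 μ))
    (E : κ → ℝ) {V : ℝ → Lp ℂ 2 μ →L[ℂ] Lp ℂ 2 μ} (hV : StronglyContinuous V)
    {W : ℝ → Lp ℂ 2 (Measure.pi fun _ : ι => μ) →L[ℂ] Lp ℂ 2 (Measure.pi fun _ : ι => μ)}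
    (hW : StronglyContinuous W)
    (hWV : ∀ t ψ, W t (tensor μ ι ψ) = ∑ i, tensor μ ι (Function.update ψ i (V t (ψ i))))
    (t : ℝ) (ψ : ι → Lp ℂ 2 μ) :
    evolution (tensorBasis ι b) (fun k => ∑ i, E (k i)) hW t (tensor μ ι ψ) =
      tensor μ ι fun i => evolution b E hV t (ψ i) := by
  have hcont : Continuous fun t => tensor μ ι fun i => evolution b E hV t (ψ i) :=
    (tensor μ ι).cont.comp (continuous_pi fun i => stronglyContinuous_evolution b E hV (ψ i))
  have h := eq_evolution_of_weak_solution (tensorBasis ι b) (fun k => ∑ i, E (k i)) hW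
    (locallyBounded_of_continuous hcont) (fun k t => ?_) t
  · simpa only [evolution_zero] using h.symm
  · simp only [tensorBasis_apply, inner_tensor, hWV, inner_sum]
    refine (hasDerivAt_prod_of_energy_add fun i =>
      hasDerivAt_inner_basis_evolution b E hV (k i) (ψ i) t).congr_deriv ?_
    push_cast
    simp only [Function.apply_update fun j => inner ℂ (b (k j))]

end Tensor

/-! ## Distinguishable particles -/

/-- The Hilbert space of `N` distinguishable particles on the ring. -/
abbrev ConfigSpace (L : ℝ) (N : ℕ) : Type := Lp ℂ 2 (ringMeasure L N)

section

variable {L : ℝ} {N : ℕ}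

variable (L N) in
/-- The product of one-particle wave functions on the ring: `tensor`, with the product measure
written as `ringMeasure`. -/
def ringTensor : ContinuousMultilinearMap ℂ (fun _ : Fin N => RingSpace L) (ConfigSpace L N) :=
  tensor ((volume : Measure ℝ).restrict (Set.Ioc 0 L)) (Fin N)

theorem coeFn_ringTensor (ψ : Fin N → RingSpace L) :
    ringTensor L N ψ =ᵐ[ringMeasure L N] fun x => ∏ i, ψ i (x i) :=
  coeFn_tensor ψ

theorem memLp_ring_prod {f : Fin N → ℝ → ℂ}
    (hf : ∀ i, MemLp (f i) 2 ((volume : Measure ℝ).restrict (Set.Ioc 0 L))) :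
    MemLp (fun x : Fin N → ℝ => ∏ i, f i (x i)) 2 (ringMeasure L N) :=
  memLp_two_prod hf

theorem ringTensor_toLp {f : Fin N → ℝ → ℂ}
    (hf : ∀ i, MemLp (f i) 2 ((volume : Measure ℝ).restrict (Set.Ioc 0 L))) :
    ringTensor L N (fun i => ((hf i).toLp (f i) : RingSpace L)) = (memLp_ring_prod hf).toLp _ :=
  tensor_toLp hf

theorem inner_ringTensor (φ ψ : Fin N → RingSpace L) :
    inner ℂ (ringTensor L N φ) (ringTensor L N ψ) = ∏ i, inner ℂ (φ i) (ψ i) :=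
  inner_tensor φ ψ

/-- The Hilbert basis of products of plane waves. -/
def configBasis (hL : 0 < L) (N : ℕ) : HilbertBasis (Fin N → ℤ) ℂ (ConfigSpace L N) :=
  tensorBasis (Fin N) (ringBasis hL)

theorem configBasis_apply (hL : 0 < L) (Λ : Fin N → ℤ) :
    configBasis hL N Λ = ringTensor L N fun i => ringBasis hL (Λ i) :=
  tensorBasis_apply (ringBasis hL) Λ

/-- The kinetic energy of a product of plane waves. -/
def configEnergy (L : ℝ) {N : ℕ} (Λ : Fin N → ℤ) : ℝ := ∑ i, ringEnergy L (Λ i)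

variable {n : ℕ}

theorem memLp_top_boxCount (L : ℝ) (N : ℕ) (b : Fin n) :
    MemLp (fun x : Fin N → ℝ => ∑ i, (box L n b).indicator (fun _ => (1 : ℂ)) (x i)) ⊤
      (ringMeasure L N) := by
  refine memLp_top_of_bound (Finset.measurable_sum _ fun i _ => ?_).aestronglyMeasurable
    (∑ _i : Fin N, 1) (Filter.Eventually.of_forall fun x =>
      (norm_sum_le _ _).trans (Finset.sum_le_sum fun i _ => ?_))
  · exact (measurable_const.indicator (measurableSet_box L n b)).comp (measurable_pi_apply i)
  · by_cases hx : x i ∈ box L n b <;> simp [hx]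

/-- The operator that counts the particles in a box. -/
def boxCount (L : ℝ) (N : ℕ) (b : Fin n) : ConfigSpace L N →L[ℂ] ConfigSpace L N :=
  mulOp (memLp_top_boxCount L N b)

/-- The potential energy operator. -/
def configPotential (L : ℝ) (N : ℕ) (v : Fin n → ℝ → ℝ) (t : ℝ) :
    ConfigSpace L N →L[ℂ] ConfigSpace L N :=
  ∑ b, (v b t : ℂ) • boxCount L N b

theorem stronglyContinuous_configPotential (L : ℝ) (N : ℕ) {v : Fin n → ℝ → ℝ}
    (hv : ∀ b, Continuous (v b)) : StronglyContinuous (configPotential L N v) :=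
  .of_continuous <| continuous_finsetSum _ fun b _ =>
    (Complex.continuous_ofReal.comp (hv b)).smul continuous_const

theorem ofReal_potential (w : Fin n → ℝ) (x : Fin N → ℝ) :
    (potential L w x : ℂ) =
      ∑ b, (w b : ℂ) * ∑ i, (box L n b).indicator (fun _ => (1 : ℂ)) (x i) := by
  simp only [potential, Finset.mul_sum]
  push_cast
  rw [Finset.sum_comm]
  refine Finset.sum_congr rfl fun b _ => Finset.sum_congr rfl fun i _ => ?_
  by_cases hx : x i ∈ box L n b <;> simp [hx]

theorem coeFn_configPotential (v : Fin n → ℝ → ℝ) (t : ℝ) (f : ConfigSpace L N) :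
    configPotential L N v t f =ᵐ[ringMeasure L N]
      fun x => (potential L (fun b => v b t) x : ℂ) * f x := by
  have hterm : ∀ᵐ x ∂(ringMeasure L N), ∀ b : Fin n, ((v b t : ℂ) • boxCount L N b f) x =
      (v b t : ℂ) * ((∑ i, (box L n b).indicator (fun _ => (1 : ℂ)) (x i)) * f x) := by
    refine ae_all_iff.mpr fun b => ?_
    filter_upwards [Lp.coeFn_smul (v b t : ℂ) (boxCount L N b f),
      coeFn_mulOp (memLp_top_boxCount L N b) f] with x hsmul hmul
    rw [hsmul, Pi.smul_apply, boxCount, hmul, smul_eq_mul]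
  simp only [configPotential, sum_apply, smul_apply]
  filter_upwards [hterm,
    Lp.coeFn_finsetSum Finset.univ fun b => (v b t : ℂ) • boxCount L N b f] with x hx hsum
  rw [hsum, Finset.sum_apply, Finset.sum_congr rfl fun b _ => hx b, ofReal_potential,
    Finset.sum_mul]
  exact Finset.sum_congr rfl fun b _ => (mul_assoc _ _ _).symm

theorem boxCount_ringTensor (b : Fin n) (ψ : Fin N → RingSpace L) :
    boxCount L N b (ringTensor L N ψ) =
      ∑ i, ringTensor L N (Function.update ψ i (boxProj L b (ψ i))) :=
  mulOp_sum_tensor (memLp_top_boxIndicator L b _) (memLp_top_boxCount L N b) ψ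

theorem configPotential_ringTensor (v : Fin n → ℝ → ℝ) (t : ℝ) (ψ : Fin N → RingSpace L) :
    configPotential L N v t (ringTensor L N ψ) =
      ∑ i, ringTensor L N (Function.update ψ i (ringPotential L v t (ψ i))) := by
  have hexpand : ∀ i, ringTensor L N (Function.update ψ i (ringPotential L v t (ψ i))) =
      ∑ b, (v b t : ℂ) • ringTensor L N (Function.update ψ i (boxProj L b (ψ i))) := by
    intro i
    simp only [ringPotential, sum_apply, smul_apply, ← ContinuousMultilinearMap.map_update_smul]
    exact (ringTensor L N).toMultilinearMap.map_update_sum Finset.univ i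
      (fun b => (v b t : ℂ) • boxProj L b (ψ i)) ψ
  simp only [hexpand, configPotential, sum_apply, smul_apply, boxCount_ringTensor, Finset.smul_sum]
  exact Finset.sum_comm

/-- The evolution of `N` distinguishable particles. -/
abbrev configEvolution (hL : 0 < L) {v : Fin n → ℝ → ℝ} (hv : ∀ b, Continuous (v b)) (N : ℕ)
    (t : ℝ) : ConfigSpace L N →L[ℂ] ConfigSpace L N :=
  evolution (configBasis hL N) (configEnergy L) (stronglyContinuous_configPotential L N hv) t

theorem configEvolution_ringTensor (hL : 0 < L) {v : Fin n → ℝ → ℝ} (hv : ∀ b, Continuous (v b))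
    (t : ℝ) (ψ : Fin N → RingSpace L) :
    configEvolution hL hv N t (ringTensor L N ψ) =
      ringTensor L N fun i => ringEvolution hL hv t (ψ i) :=
  evolution_tensor (ringBasis hL) (ringEnergy L) (stronglyContinuous_ringPotential L hv)
    (stronglyContinuous_configPotential L N hv) (configPotential_ringTensor v) t ψ

/-! ## Permutations of the particles -/

/-- The action of a permutation of the particles. -/
def permOp (L : ℝ) (σ : Equiv.Perm (Fin N)) : ConfigSpace L N →ₗᵢ[ℂ] ConfigSpace L N :=
  Lp.compMeasurePreservingₗᵢ ℂ (fun x : Fin N → ℝ => x ∘ σ) (measurePreserving_perm L σ)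

theorem coeFn_permOp (σ : Equiv.Perm (Fin N)) (f : ConfigSpace L N) :
    permOp L σ f =ᵐ[ringMeasure L N] fun x => f (x ∘ σ) :=
  Lp.coeFn_compMeasurePreserving f (measurePreserving_perm L σ)

theorem ae_comp_perm (σ : Equiv.Perm (Fin N)) {p : (Fin N → ℝ) → Prop}
    (h : ∀ᵐ x ∂(ringMeasure L N), p x) : ∀ᵐ x ∂(ringMeasure L N), p (x ∘ σ) :=
  (measurePreserving_perm L σ).quasiMeasurePreserving.ae h

theorem permOp_ringTensor (σ : Equiv.Perm (Fin N)) (ψ : Fin N → RingSpace L) :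
    permOp L σ (ringTensor L N (ψ ∘ σ)) = ringTensor L N ψ := by
  refine Lp.ext ?_
  filter_upwards [coeFn_permOp σ (ringTensor L N (ψ ∘ σ)), coeFn_ringTensor ψ,
    ae_comp_perm σ (coeFn_ringTensor (ψ ∘ σ))] with x hperm hψ hψσ
  rw [hperm, hψσ, hψ]
  exact Equiv.prod_comp σ fun i => ψ i (x i)

theorem potential_perm (w : Fin n → ℝ) (σ : Equiv.Perm (Fin N)) (x : Fin N → ℝ) :
    potential L w (x ∘ σ) = potential L w x :=
  Equiv.sum_comp σ fun i => ∑ b : Fin n, (box L n b).indicator (fun _ => w b) (x i)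

theorem permOp_configPotential (v : Fin n → ℝ → ℝ) (σ : Equiv.Perm (Fin N)) (t : ℝ)
    (f : ConfigSpace L N) :
    permOp L σ (configPotential L N v t f) = configPotential L N v t (permOp L σ f) := by
  refine Lp.ext ?_
  filter_upwards [coeFn_permOp σ (configPotential L N v t f), coeFn_permOp σ f,
    coeFn_configPotential v t (permOp L σ f), ae_comp_perm σ (coeFn_configPotential v t f)]
    with x hpermV hperm hVperm hV
  rw [hpermV, hVperm, hV, hperm, potential_perm]

theorem configEnergy_perm (σ : Equiv.Perm (Fin N)) (Λ : Fin N → ℤ) :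
    configEnergy L (Λ ∘ σ) = configEnergy L Λ :=
  Equiv.sum_comp σ fun i => ringEnergy L (Λ i)

variable (hL : 0 < L)

theorem inner_configBasis_permOp (σ : Equiv.Perm (Fin N)) (Λ : Fin N → ℤ) (f : ConfigSpace L N) :
    inner ℂ (configBasis hL N Λ) (permOp L σ f) = inner ℂ (configBasis hL N (Λ ∘ σ)) f := by
  rw [configBasis_apply, configBasis_apply, ← permOp_ringTensor σ, LinearIsometry.inner_map_map]
  rfl

theorem permOp_configEvolution {v : Fin n → ℝ → ℝ} (hv : ∀ b, Continuous (v b))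
    (σ : Equiv.Perm (Fin N)) (t : ℝ) (f : ConfigSpace L N) :
    permOp L σ (configEvolution hL hv N t f) = configEvolution hL hv N t (permOp L σ f) := by
  have hV := stronglyContinuous_configPotential L N hv
  have h := eq_evolution_of_weak_solution (configBasis hL N) (configEnergy L) hV
    (y := fun t => permOp L σ (configEvolution hL hv N t f))
    (locallyBounded_of_continuous
      ((permOp L σ).continuous.comp (stronglyContinuous_evolution _ _ hV f))) (fun Λ t => ?_) t
  · simpa only [evolution_zero] using h
  · rw [← permOp_configPotential]
    simp only [inner_configBasis_permOp, ← configEnergy_perm σ Λ]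
    exact hasDerivAt_inner_basis_evolution _ _ hV (Λ ∘ σ) f t

end

/-! ## Exchanging bosons and fermions -/

theorem real_sign_mul (r s : ℝ) : Real.sign (r * s) = Real.sign r * Real.sign s := by
  rcases lt_trichotomy r 0 with hr | hr | hr <;> rcases lt_trichotomy s 0 with hs | hs | hs <;>
    simp [Real.sign_of_neg, Real.sign_of_pos, hr, hs, mul_neg_of_neg_of_pos,
      mul_neg_of_pos_of_neg, mul_pos_of_neg_of_neg]

theorem real_sign_prod {ι : Type*} (s : Finset ι) (f : ι → ℝ) :
    Real.sign (∏ i ∈ s, f i) = ∏ i ∈ s, Real.sign (f i) := by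
  classical
  induction s using Finset.induction with
  | empty => simp
  | insert i s hi ih => rw [Finset.prod_insert hi, Finset.prod_insert hi, real_sign_mul, ih]

theorem eventually_sign_eq {r : ℝ} (hr : r ≠ 0) : ∀ᶠ s in nhds r, Real.sign s = Real.sign r := by
  rcases hr.lt_or_gt with h | h
  · filter_upwards [Iio_mem_nhds h] with s hs
    rw [Real.sign_of_neg hs, Real.sign_of_neg h]
  · filter_upwards [Ioi_mem_nhds h] with s hs
    rw [Real.sign_of_pos hs, Real.sign_of_pos h]

section

variable {ι : Type*} [Fintype ι]

theorem ae_ne_of_ne {i j : ι} (hij : i ≠ j) : ∀ᵐ x : ι → ℝ, x i ≠ x j := by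
  classical
  let s : Submodule ℝ (ι → ℝ) :=
    LinearMap.ker ((LinearMap.proj i : (ι → ℝ) →ₗ[ℝ] ℝ) - LinearMap.proj j)
  have hs : s ≠ ⊤ := fun h => by
    have : (Pi.single i 1 : ι → ℝ) ∈ s := h ▸ Submodule.mem_top
    simp [s, hij.symm] at this
  refine measure_mono_null (fun x hx => ?_) (Measure.addHaar_submodule volume s hs)
  have hx' : x i = x j := by simpa using hx
  simp [s, hx']

theorem ae_injective : ∀ᵐ x : ι → ℝ, Function.Injective x := by
  have h : ∀ᵐ x : ι → ℝ, ∀ i j : ι, i ≠ j → x i ≠ x j :=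
    ae_all_iff.mpr fun _ => ae_all_iff.mpr fun _ =>
      Filter.eventually_imp_distrib_left.mpr ae_ne_of_ne
  filter_upwards [h] with x hx i j
  exact not_imp_not.mp (hx i j)

variable [LinearOrder ι]

theorem signProd_mul_self {x : ι → ℝ} (hx : Function.Injective x) :
    signProd x * signProd x = 1 := by
  rw [signProd, ← Finset.prod_mul_distrib]
  refine Finset.prod_eq_one fun p hp => ?_
  have hne : x p.1 - x p.2 ≠ 0 := sub_ne_zero.mpr (hx.ne (Finset.mem_filter.mp hp).2.ne)
  rcases Real.sign_apply_eq_of_ne_zero _ hne with h | h <;> simp [h]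

theorem measurable_signProd : Measurable fun x : ι → ℝ => signProd x :=
  Finset.measurable_prod _ fun p _ => measurable_sgn.comp (by fun_prop)

theorem norm_signProd_le (x : ι → ℝ) : ‖signProd x‖ ≤ 1 := by
  rw [signProd, norm_prod]
  exact Finset.prod_le_one (fun _ _ => norm_nonneg _) fun p _ => norm_sgn_le _

theorem eventually_signProd_eq {x : ι → ℝ} (hx : Function.Injective x) :
    ∀ᶠ y in nhds x, signProd y = signProd x := by
  have h : ∀ᶠ y in nhds x, ∀ p ∈ ({p | p.1 < p.2} : Finset (ι × ι)),
      Real.sign (y p.1 - y p.2) = Real.sign (x p.1 - x p.2) := by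
    refine (Filter.eventually_all_finset _).mpr fun p hp => ?_
    have hcont : ContinuousAt (fun y : ι → ℝ => y p.1 - y p.2) x := by fun_prop
    exact hcont.eventually
      (eventually_sign_eq (sub_ne_zero.mpr (hx.ne (Finset.mem_filter.mp hp).2.ne)))
  filter_upwards [h] with y hy using Finset.prod_congr rfl hy

end

section

variable {L : ℝ} {N : ℕ}

-- The negated nodes turn the factors `x_j - x_i` of the Vandermonde determinant into `x_i - x_j`.
theorem signProd_eq_sign_det (x : Fin N → ℝ) :
    signProd x = Real.sign (Matrix.vandermonde (-x)).det := by
  rw [Matrix.det_vandermonde, real_sign_prod, signProd, Finset.prod_filter,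
    Fintype.prod_prod_type]
  refine Finset.prod_congr rfl fun i _ => ?_
  rw [real_sign_prod, ← Finset.prod_filter]
  refine Finset.prod_congr (by ext j; simp) fun j _ => ?_
  rw [Pi.neg_apply, Pi.neg_apply, neg_sub_neg]

theorem signProd_perm (σ : Equiv.Perm (Fin N)) (x : Fin N → ℝ) :
    signProd (x ∘ σ) = ((Equiv.Perm.sign σ : ℤ) : ℝ) * signProd x := by
  have h : Matrix.vandermonde (-(x ∘ σ)) = (Matrix.vandermonde (-x)).submatrix σ id := rfl
  rw [signProd_eq_sign_det, signProd_eq_sign_det, h, Matrix.det_permute, real_sign_mul]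
  rcases Int.units_eq_one_or (Equiv.Perm.sign σ) with h | h <;> simp [h, Real.sign_neg]

theorem sign_mul_sign (σ : Equiv.Perm (Fin N)) :
    ((Equiv.Perm.sign σ : ℤ) : ℂ) * ((Equiv.Perm.sign σ : ℤ) : ℂ) = 1 := by
  rw [← Int.cast_mul, Int.units_coe_mul_self, Int.cast_one]

theorem ringMeasure_absolutelyContinuous (L : ℝ) (N : ℕ) : ringMeasure L N ≪ volume := by
  rw [ringMeasure, ← Measure.restrict_pi_pi]
  exact Measure.absolutelyContinuous_of_le Measure.restrict_le_self

theorem ae_ringMeasure_injective (L : ℝ) (N : ℕ) :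
    ∀ᵐ x ∂(ringMeasure L N), Function.Injective x :=
  (ringMeasure_absolutelyContinuous L N).ae_le ae_injective

theorem memLp_top_signProd (L : ℝ) (N : ℕ) :
    MemLp (fun x : Fin N → ℝ => (signProd x : ℂ)) ⊤ (ringMeasure L N) :=
  memLp_top_of_bound (Complex.measurable_ofReal.comp measurable_signProd).aestronglyMeasurable 1
    (Filter.Eventually.of_forall fun x => (Complex.norm_real _).trans_le (norm_signProd_le x))

/-- Multiplication by the sign factor `∏_{i<j} sgn (x_i - x_j)`, which exchanges bosonic and
fermionic wave functions. -/
def signOp (L : ℝ) (N : ℕ) : ConfigSpace L N →L[ℂ] ConfigSpace L N :=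
  mulOp (memLp_top_signProd L N)

theorem coeFn_signOp (f : ConfigSpace L N) :
    signOp L N f =ᵐ[ringMeasure L N] fun x => (signProd x : ℂ) * f x :=
  coeFn_mulOp _ f

theorem signOp_signOp (f : ConfigSpace L N) : signOp L N (signOp L N f) = f := by
  refine Lp.ext ?_
  filter_upwards [coeFn_signOp (signOp L N f), coeFn_signOp f,
    ae_ringMeasure_injective L N] with x h1 h2 hx
  rw [h1, h2, ← mul_assoc, ← Complex.ofReal_mul, signProd_mul_self hx, Complex.ofReal_one, one_mul]

theorem inner_signOp_left (f g : ConfigSpace L N) :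
    inner ℂ (signOp L N f) g = inner ℂ f (signOp L N g) := by
  rw [inner_eq_integral, inner_eq_integral]
  refine integral_congr_ae ?_
  filter_upwards [coeFn_signOp f, coeFn_signOp g] with x h1 h2
  rw [h1, h2, map_mul, Complex.conj_ofReal]
  ring

theorem permOp_signOp (σ : Equiv.Perm (Fin N)) (f : ConfigSpace L N) :
    permOp L σ (signOp L N f) =
      ((Equiv.Perm.sign σ : ℤ) : ℂ) • signOp L N (permOp L σ f) := by
  refine Lp.ext ?_
  filter_upwards [coeFn_permOp σ (signOp L N f), ae_comp_perm σ (coeFn_signOp f),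
    Lp.coeFn_smul ((Equiv.Perm.sign σ : ℤ) : ℂ) (signOp L N (permOp L σ f)),
    coeFn_signOp (permOp L σ f), coeFn_permOp σ f] with x hpermS hS hsmul hSperm hperm
  rw [hpermS, hS, hsmul, Pi.smul_apply, hSperm, hperm, signProd_perm, smul_eq_mul]
  push_cast
  ring

theorem mem_bosonSpace_iff {f : ConfigSpace L N} :
    f ∈ BosonSpace L N ↔ ∀ σ : Equiv.Perm (Fin N), permOp L σ f = f := by
  refine forall_congr' fun σ => ⟨fun h => Lp.ext ((coeFn_permOp σ f).trans h), fun h => ?_⟩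
  have hperm := coeFn_permOp σ f
  rw [h] at hperm
  exact hperm.symm

theorem permOp_signOp_boson (σ : Equiv.Perm (Fin N)) (Ψ : BosonSpace L N) :
    permOp L σ (signOp L N (Ψ : ConfigSpace L N)) =
      ((Equiv.Perm.sign σ : ℤ) : ℂ) • signOp L N (Ψ : ConfigSpace L N) := by
  rw [permOp_signOp, mem_bosonSpace_iff.mp Ψ.2]

theorem signOp_mem_bosonSpace {f : ConfigSpace L N}
    (hf : ∀ σ : Equiv.Perm (Fin N), permOp L σ f = ((Equiv.Perm.sign σ : ℤ) : ℂ) • f) :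
    signOp L N f ∈ BosonSpace L N := by
  refine mem_bosonSpace_iff.mpr fun σ => ?_
  rw [permOp_signOp, hf, map_smul, smul_smul, sign_mul_sign, one_smul]

variable (hL : 0 < L) {n : ℕ} {v : Fin n → ℝ → ℝ} (hv : ∀ b, Continuous (v b))

theorem signOp_configEvolution_signOp_mem (t : ℝ) (Ψ : BosonSpace L N) :
    signOp L N (configEvolution hL hv N t (signOp L N (Ψ : ConfigSpace L N))) ∈
      BosonSpace L N := by
  refine signOp_mem_bosonSpace fun σ => ?_
  rw [permOp_configEvolution, permOp_signOp_boson, map_smul]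

/-- The evolution operator of `N` hardcore bosons: the evolution of distinguishable particles,
transported from fermionic to bosonic wave functions by the sign factor. -/
def bosonEvolution (N : ℕ) (t : ℝ) : BosonSpace L N →L[ℂ] BosonSpace L N :=
  ((signOp L N).comp ((configEvolution hL hv N t).comp
    ((signOp L N).comp (BosonSpace L N).subtypeL))).codRestrict (BosonSpace L N)
      (signOp_configEvolution_signOp_mem hL hv t)

theorem coe_bosonEvolution (t : ℝ) (Ψ : BosonSpace L N) :
    (bosonEvolution hL hv N t Ψ : ConfigSpace L N) =
      signOp L N (configEvolution hL hv N t (signOp L N (Ψ : ConfigSpace L N))) := rfl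

theorem signOp_bosonEvolution (t : ℝ) (Ψ : BosonSpace L N) :
    signOp L N (bosonEvolution hL hv N t Ψ : ConfigSpace L N) =
      configEvolution hL hv N t (signOp L N (Ψ : ConfigSpace L N)) := by
  rw [coe_bosonEvolution, signOp_signOp]

end

/-! ## The kinetic energy on the core -/

section

variable {ι : Type*} [DecidableEq ι]

/-- The partial derivative of a function of finitely many real variables in the `j`-th variable. -/
def partialDeriv (j : ι) (g : (ι → ℝ) → ℂ) (x : ι → ℝ) : ℂ :=
  fderiv ℝ g x (Pi.single j 1)

theorem hasDerivAt_comp_update [Finite ι] {g : (ι → ℝ) → ℂ} (hg : Differentiable ℝ g) (j : ι)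
    (x : ι → ℝ) (s : ℝ) :
    HasDerivAt (fun s => g (Function.update x j s))
      (partialDeriv j g (Function.update x j s)) s := by
  have := Fintype.ofFinite ι
  exact (hg (Function.update x j s)).hasFDerivAt.comp_hasDerivAt s (hasDerivAt_update x j s)

variable [Fintype ι]

theorem contDiff_partialDeriv {g : (ι → ℝ) → ℂ} (hg : ContDiff ℝ 2 g) (j : ι) :
    ContDiff ℝ 1 (partialDeriv j g) :=
  (hg.fderiv_right (m := 1) (by norm_num)).clm_apply contDiff_const

theorem continuous_partialDeriv_partialDeriv {g : (ι → ℝ) → ℂ} (hg : ContDiff ℝ 2 g) (j : ι) :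
    Continuous (partialDeriv j (partialDeriv j g)) :=
  ((contDiff_partialDeriv hg j).continuous_fderiv (by norm_num)).clm_apply continuous_const

theorem iteratedDeriv_two_comp_update {g : (ι → ℝ) → ℂ} (hg : ContDiff ℝ 2 g) (j : ι)
    (x : ι → ℝ) :
    iteratedDeriv 2 (fun s => g (Function.update x j s)) (x j) =
      partialDeriv j (partialDeriv j g) x := by
  have hderiv : deriv (fun s => g (Function.update x j s)) =
      fun s => partialDeriv j g (Function.update x j s) :=
    funext fun s => (hasDerivAt_comp_update (hg.differentiable (by norm_num)) j x s).deriv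
  rw [iteratedDeriv_succ, iteratedDeriv_one, hderiv,
    (hasDerivAt_comp_update ((contDiff_partialDeriv hg j).differentiable (by norm_num)) j x
      (x j)).deriv,
    Function.update_eq_self]

/-- The kinetic energy `-∑_j ∂_j² g` of a smooth wave function. -/
def kinetic (g : (ι → ℝ) → ℂ) (x : ι → ℝ) : ℂ :=
  -∑ j, partialDeriv j (partialDeriv j g) x

theorem continuous_kinetic {g : (ι → ℝ) → ℂ} (hg : ContDiff ℝ 2 g) : Continuous (kinetic g) :=
  (continuous_finsetSum _ fun j _ => continuous_partialDeriv_partialDeriv hg j).neg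

end

section

variable {L : ℝ} {N : ℕ}

theorem memLp_of_continuous {g : (Fin N → ℝ) → ℂ} (hg : Continuous g) (p : ENNReal) :
    MemLp g p (ringMeasure L N) := by
  have hK : IsCompact (Set.univ.pi fun _ : Fin N => Set.Icc 0 L) :=
    isCompact_univ_pi fun _ => isCompact_Icc
  obtain ⟨C, hC⟩ := hK.exists_bound_of_continuousOn hg.continuousOn
  have hring : ∀ᵐ x ∂(ringMeasure L N), ∀ i, x i ∈ Set.Ioc 0 L :=
    ae_forall_eval fun _ => ae_restrict_mem measurableSet_Ioc
  refine MemLp.of_bound hg.aestronglyMeasurable C ?_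
  filter_upwards [hring] with x hx
  exact hC x fun i _ => Set.Ioc_subset_Icc_self (hx i)

theorem integrable_of_continuous {g : (Fin N → ℝ) → ℂ} (hg : Continuous g) :
    Integrable g (ringMeasure L N) :=
  memLp_one_iff_integrable.mp (memLp_of_continuous hg 1)

theorem iteratedDeriv_two_signProd_mul {g : (Fin N → ℝ) → ℂ} (hg : ContDiff ℝ 2 g)
    {x : Fin N → ℝ} (hx : Function.Injective x) (j : Fin N) :
    iteratedDeriv 2 (fun s => (signProd (Function.update x j s) : ℂ) * g (Function.update x j s))
        (x j) =
      (signProd x : ℂ) * partialDeriv j (partialDeriv j g) x := by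
  have hcont : ContinuousAt (fun s : ℝ => Function.update x j s) (x j) :=
    (continuous_const.update j continuous_id).continuousAt
  have hsign : ∀ᶠ y in nhds (Function.update x j (x j)), signProd y = signProd x := by
    rw [Function.update_eq_self]
    exact eventually_signProd_eq hx
  have hlocal :
      (fun s => (signProd (Function.update x j s) : ℂ) * g (Function.update x j s)) =ᶠ[nhds (x j)]
        fun s => (signProd x : ℂ) * g (Function.update x j s) := by
    filter_upwards [hcont.eventually hsign] with s hs
    rw [hs]
  rw [hlocal.iteratedDeriv_eq, iteratedDeriv_const_mul_field, iteratedDeriv_two_comp_update hg]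

theorem hamiltonian_ae_eq {n : ℕ} (w : Fin n → ℝ) {f g : (Fin N → ℝ) → ℂ}
    (hg : ContDiff ℝ 2 g) (hf : ∀ x, f x = (signProd x : ℂ) * g x) :
    hamiltonian L w f =ᵐ[ringMeasure L N]
      fun x => (signProd x : ℂ) * (kinetic g x + (potential L w x : ℂ) * g x) := by
  filter_upwards [ae_ringMeasure_injective L N] with x hx
  simp only [hamiltonian, hf, iteratedDeriv_two_signProd_mul hg hx]
  rw [kinetic, ← Finset.mul_sum]
  ring

theorem integral_eq_zero_of_forall_integral_update_eq_zero {μ : Measure ℝ} [SigmaFinite μ]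
    (j : Fin N) {F : (Fin N → ℝ) → ℂ} (hF : Integrable F (Measure.pi fun _ => μ))
    (h : ∀ x, ∫ s, F (Function.update x j s) ∂μ = 0) :
    ∫ x, F x ∂(Measure.pi fun _ => μ) = 0 := by
  cases N with
  | zero => exact j.elim0
  | succ M =>
    have hmp := (measurePreserving_piFinSuccAbove (fun _ : Fin (M + 1) => μ) j).symm
    rw [← hmp.integral_comp', integral_prod_symm]
    · refine integral_eq_zero_of_ae (Filter.Eventually.of_forall fun z => ?_)
      have hz := h (Fin.insertNth j 0 z)
      simp only [Fin.update_insertNth] at hz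
      exact hz
    · exact (hmp.integrable_comp_emb (MeasurableEquiv.measurableEmbedding _)).mpr hF

theorem ringWave_add_period (hL : L ≠ 0) (m : ℤ) (s : ℝ) :
    ringWave L m (s + L) = -ringWave L m s := by
  have hL' : (L : ℂ) ≠ 0 := Complex.ofReal_ne_zero.mpr hL
  have hphase : I * ((ringMomentum L m : ℂ) * ((s + L : ℝ) : ℂ)) =
      I * ((ringMomentum L m : ℂ) * (s : ℂ)) + (Real.pi * I + m * (2 * Real.pi * I)) := by
    rw [ringMomentum]
    push_cast
    field_simp
    ring
  rw [ringWave, planeWave, planeWave, hphase, Complex.exp_add, Complex.exp_add,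
    Complex.exp_int_mul_two_pi_mul_I, Complex.exp_pi_mul_I]
  ring

theorem hasDerivAt_antiperiodic {G G' : ℝ → ℂ} (h : ∀ s, HasDerivAt G (G' s) s)
    (hG : ∀ s, G (s + L) = -G s) (s : ℝ) : G' (s + L) = -G' s := by
  have hshift : HasDerivAt (fun s => G (s + L)) (G' (s + L)) s := (h (s + L)).comp_add_const s L
  rw [funext hG] at hshift
  exact hshift.unique (h s).fun_neg

-- The integrand is the derivative of the `L`-periodic function `s ↦ conj (ringWave L m s) *
-- (G' s + I * ringMomentum L m * G s)`.
theorem integral_conj_ringWave_mul_eq_zero (hL : 0 < L) (m : ℤ) {G G' G'' : ℝ → ℂ}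
    (h1 : ∀ s, HasDerivAt G (G' s) s) (h2 : ∀ s, HasDerivAt G' (G'' s) s) (hc : Continuous G'')
    (hG : ∀ s, G (s + L) = -G s) :
    ∫ s in Set.Ioc 0 L, conj (ringWave L m s) * (G'' s + (ringEnergy L m : ℂ) * G s) = 0 := by
  have hprim : ∀ s, HasDerivAt
      (fun s => conj (ringWave L m s) * (G' s + I * ringMomentum L m * G s))
      (conj (ringWave L m s) * (G'' s + (ringEnergy L m : ℂ) * G s)) s := by
    intro s
    simp only [conj_planeWave]
    refine ((hasDerivAt_planeWave _ _ s).fun_mul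
      ((h2 s).fun_add ((h1 s).const_mul _))).congr_deriv ?_
    rw [ringEnergy]
    push_cast
    linear_combination
      (-planeWave L (-ringMomentum L m) s * (ringMomentum L m : ℂ) ^ 2 * G s) * I_mul_I
  have hGc : Continuous G := continuous_iff_continuousAt.mpr fun s => (h1 s).continuousAt
  have : Continuous fun s => conj (ringWave L m s) :=
    Complex.continuous_conj.comp (continuous_planeWave L _)
  rw [← intervalIntegral.integral_of_le hL.le,
    intervalIntegral.integral_eq_sub_of_hasDerivAt (fun s _ => hprim s)
      (Continuous.intervalIntegrable (by fun_prop) _ _)]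
  have hGL := hG 0
  have hGL' := hasDerivAt_antiperiodic h1 hG 0
  have hwL := ringWave_add_period hL.ne' m 0
  rw [zero_add] at hGL hGL' hwL
  rw [hGL, hGL', hwL, map_neg]
  ring

theorem continuous_prod_ringWave (Λ : Fin N → ℤ) :
    Continuous fun x : Fin N → ℝ => ∏ i, ringWave L (Λ i) (x i) :=
  continuous_finsetProd _ fun i _ => (continuous_planeWave L _).comp (continuous_apply i)

theorem integral_conj_prod_ringWave_mul_partialDeriv (hL : 0 < L) {g : (Fin N → ℝ) → ℂ}
    (hg : ContDiff ℝ 2 g) {j : Fin N}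
    (hp : ∀ x : Fin N → ℝ, g (Function.update x j (x j + L)) = -g x) (Λ : Fin N → ℤ) :
    ∫ x, conj (∏ i, ringWave L (Λ i) (x i)) * partialDeriv j (partialDeriv j g) x
        ∂(ringMeasure L N) =
      -((ringEnergy L (Λ j) : ℂ) *
        ∫ x, conj (∏ i, ringWave L (Λ i) (x i)) * g x ∂(ringMeasure L N)) := by
  have := Complex.continuous_conj.comp (continuous_prod_ringWave (L := L) Λ)
  have hgc := hg.continuous
  have hgc' := continuous_partialDeriv_partialDeriv hg j
  rw [← integral_const_mul, eq_neg_iff_add_eq_zero, ← integral_add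
    (integrable_of_continuous (by fun_prop)) (integrable_of_continuous (by fun_prop))]
  refine integral_eq_zero_of_forall_integral_update_eq_zero j
    (integrable_of_continuous (by fun_prop)) fun x => ?_
  have hfactor : ∀ s,
      conj (∏ i, ringWave L (Λ i) (Function.update x j s i)) *
          partialDeriv j (partialDeriv j g) (Function.update x j s) +
        ringEnergy L (Λ j) * (conj (∏ i, ringWave L (Λ i) (Function.update x j s i)) *
          g (Function.update x j s)) =
      conj (∏ i ∈ Finset.univ.erase j, ringWave L (Λ i) (x i)) *
        (conj (ringWave L (Λ j) s) * (partialDeriv j (partialDeriv j g) (Function.update x j s) +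
          ringEnergy L (Λ j) * g (Function.update x j s))) := by
    intro s
    have hrest : ∏ i ∈ Finset.univ.erase j, ringWave L (Λ i) (Function.update x j s i) =
        ∏ i ∈ Finset.univ.erase j, ringWave L (Λ i) (x i) :=
      Finset.prod_congr rfl fun i hi => by
        rw [Function.update_of_ne (Finset.ne_of_mem_erase hi)]
    rw [← Finset.mul_prod_erase _ _ (Finset.mem_univ j), hrest, Function.update_self, map_mul]
    ring
  simp only [hfactor]
  rw [integral_const_mul, integral_conj_ringWave_mul_eq_zero hL (Λ j)
    (hasDerivAt_comp_update (hg.differentiable (by norm_num)) j x)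
    (hasDerivAt_comp_update ((contDiff_partialDeriv hg j).differentiable (by norm_num)) j x)
    (hgc'.comp (continuous_const.update j continuous_id))
    (fun s => by simpa using hp (Function.update x j s)), mul_zero]

theorem configBasis_eq_toLp (hL : 0 < L) (Λ : Fin N → ℤ) :
    configBasis hL N Λ =
      (memLp_of_continuous (continuous_prod_ringWave (L := L) Λ) 2).toLp _ := by
  simp only [configBasis_apply, ringBasis_apply]
  exact ringTensor_toLp fun i => memLp_planeWave L _ _

theorem inner_configBasis_kinetic (hL : 0 < L) {g : (Fin N → ℝ) → ℂ} (hg : ContDiff ℝ 2 g)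
    (hp : ∀ (j : Fin N) (x : Fin N → ℝ), g (Function.update x j (x j + L)) = -g x)
    (Λ : Fin N → ℤ) :
    inner ℂ (configBasis hL N Λ)
        ((memLp_of_continuous (continuous_kinetic hg) 2).toLp _ : ConfigSpace L N) =
      (configEnergy L Λ : ℂ) * inner ℂ (configBasis hL N Λ)
        ((memLp_of_continuous hg.continuous 2).toLp _ : ConfigSpace L N) := by
  have hwave := Complex.continuous_conj.comp (continuous_prod_ringWave (L := L) Λ)
  have hint : ∀ j, Integrable (fun x => conj (∏ i, ringWave L (Λ i) (x i)) *
      partialDeriv j (partialDeriv j g) x) (ringMeasure L N) := fun j =>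
    integrable_of_continuous (hwave.mul (continuous_partialDeriv_partialDeriv hg j))
  rw [configBasis_eq_toLp, inner_toLp_toLp, inner_toLp_toLp]
  simp only [kinetic, mul_neg, Finset.mul_sum]
  rw [integral_neg, integral_finsetSum _ fun j _ => hint j]
  simp only [integral_conj_prod_ringWave_mul_partialDeriv hL hg (hp _), Finset.sum_neg_distrib,
    neg_neg, ← Finset.sum_mul, configEnergy]
  push_cast
  rfl

/-! ## The evolution operator of hardcore bosons -/

theorem integral_conj_mul_of_eq_signProd_mul {f g : (Fin N → ℝ) → ℂ}
    (hg : MemLp g 2 (ringMeasure L N)) (hf : ∀ x, f x = (signProd x : ℂ) * g x)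
    (Φ : ConfigSpace L N) :
    ∫ x, conj (f x) * Φ x ∂(ringMeasure L N) = inner ℂ (hg.toLp g) (signOp L N Φ) := by
  rw [inner_toLp_left]
  refine integral_congr_ae ?_
  filter_upwards [coeFn_signOp Φ] with x hx
  rw [hx, hf, map_mul, Complex.conj_ofReal]
  ring

theorem integrable_conj_mul {X : Type*} [MeasurableSpace X] {μ : Measure X} {f : X → ℂ}
    (hf : MemLp f 2 μ) (Φ : Lp ℂ 2 μ) : Integrable (fun x => conj (f x) * Φ x) μ :=
  hf.star.integrable_mul (Lp.memLp Φ)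

theorem integral_conj_hamiltonian_mul {n : ℕ} (v : Fin n → ℝ → ℝ) (t : ℝ)
    {f g : (Fin N → ℝ) → ℂ} (hg : ContDiff ℝ 2 g) (hf : ∀ x, f x = (signProd x : ℂ) * g x)
    (Φ : ConfigSpace L N) :
    ∫ x, conj (hamiltonian L (fun b => v b t) f x) * Φ x ∂(ringMeasure L N) =
      inner ℂ ((memLp_of_continuous (continuous_kinetic hg) 2).toLp _ : ConfigSpace L N)
          (signOp L N Φ) +
        inner ℂ ((memLp_of_continuous hg.continuous 2).toLp _ : ConfigSpace L N)
          (configPotential L N v t (signOp L N Φ)) := by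
  rw [inner_toLp_left, inner_toLp_left, ← integral_add
    (integrable_conj_mul (memLp_of_continuous (continuous_kinetic hg) 2) _)
    (integrable_conj_mul (memLp_of_continuous hg.continuous 2) _)]
  refine integral_congr_ae ?_
  filter_upwards [hamiltonian_ae_eq (L := L) (fun b => v b t) hg hf, coeFn_signOp Φ,
    coeFn_configPotential v t (signOp L N Φ)] with x hH hS hV
  rw [hH, hV, hS]
  simp only [map_mul, map_add, Complex.conj_ofReal]
  ring

theorem isEvolutionOperator_bosonEvolution (hL : 0 < L) {n : ℕ} {v : Fin n → ℝ → ℝ}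
    (hv : ∀ b, Continuous (v b)) (hN : Even N) :
    IsEvolutionOperator L v N (bosonEvolution hL hv N) where
  initial := by
    ext1 Ψ
    refine Subtype.ext ?_
    rw [coe_bosonEvolution, evolution_zero, signOp_signOp]
    rfl
  continuous Ψ :=
    ((signOp L N).continuous.comp (stronglyContinuous_evolution _ _
      (stronglyContinuous_configPotential L N hv) _)).subtype_mk _
  schrodinger Ψ f hf t := by
    obtain ⟨g, hg, -, hp, hfg⟩ := hf
    simp only [integral_conj_mul_of_eq_signProd_mul (memLp_of_continuous hg.continuous 2) hfg,
      integral_conj_hamiltonian_mul v t hg hfg, signOp_bosonEvolution]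
    refine hasDerivAt_inner_evolution _ _ _ (inner_configBasis_kinetic hL hg fun j x => ?_) _ t
    rw [hp, hN.add_one.neg_one_pow, neg_one_mul]

end

/-! ## Slater determinants -/

section

variable {ι : Type*} [Fintype ι] [DecidableEq ι]

/-- The (unnormalised) Slater determinant of the one-particle wave functions `f i`. -/
def slaterDet (f : ι → ℝ → ℂ) (x : ι → ℝ) : ℂ :=
  Matrix.det (Matrix.of fun i j => f i (x j))

theorem slaterDet_eq_sum (f : ι → ℝ → ℂ) (x : ι → ℝ) :
    slaterDet f x =
      ∑ σ : Equiv.Perm ι, ((Equiv.Perm.sign σ : ℤ) : ℂ) * ∏ i, f (σ i) (x i) :=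
  Matrix.det_apply' _

theorem slaterDet_perm (f : ι → ℝ → ℂ) (σ : Equiv.Perm ι) (x : ι → ℝ) :
    slaterDet f (x ∘ σ) = ((Equiv.Perm.sign σ : ℤ) : ℂ) * slaterDet f x :=
  Matrix.det_permute' σ (Matrix.of fun i j => f i (x j))

theorem slaterDet_update_add {f : ι → ℝ → ℂ} {L : ℝ} {c : ℂ}
    (hf : ∀ i s, f i (s + L) = c * f i s) (j : ι) (x : ι → ℝ) :
    slaterDet f (Function.update x j (x j + L)) = c * slaterDet f x := by
  let M : Matrix ι ι ℂ := Matrix.of fun i k => f i (x k)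
  have hM : (Matrix.of fun i k => f i (Function.update x j (x j + L) k)) =
      M.updateCol j (c • M.col j) := by
    ext i k
    by_cases hk : k = j
    · subst hk
      simp [M, hf]
    · simp [M, hk]
  rw [slaterDet, hM, Matrix.det_updateCol_smul]
  exact congrArg (c * Matrix.det ·) (M.updateCol_eq_self j)

theorem contDiff_slaterDet {f : ι → ℝ → ℂ} {k : WithTop ℕ∞} (hf : ∀ i, ContDiff ℝ k (f i)) :
    ContDiff ℝ k (slaterDet f) := by
  rw [funext (slaterDet_eq_sum f)]
  exact ContDiff.sum fun σ _ => contDiff_const.mul <| contDiff_prod fun i _ =>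
    (hf (σ i)).comp (contDiff_apply ℝ ℝ i)

end

section

variable {L : ℝ} {N : ℕ}

/-- The (unnormalised) Slater determinant of one-particle wave functions on the ring, as a vector
of the space of distinguishable particles. -/
def slaterVec (ψ : Fin N → RingSpace L) : ConfigSpace L N :=
  ∑ σ : Equiv.Perm (Fin N), ((Equiv.Perm.sign σ : ℤ) : ℂ) • ringTensor L N (ψ ∘ σ)

theorem coeFn_slaterVec (ψ : Fin N → RingSpace L) :
    slaterVec ψ =ᵐ[ringMeasure L N] slaterDet fun i => ψ i := by
  have hterm : ∀ᵐ x ∂(ringMeasure L N), ∀ σ : Equiv.Perm (Fin N),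
      (((Equiv.Perm.sign σ : ℤ) : ℂ) • ringTensor L N (ψ ∘ σ)) x =
        ((Equiv.Perm.sign σ : ℤ) : ℂ) * ∏ i, ψ (σ i) (x i) := by
    refine ae_all_iff.mpr fun σ => ?_
    filter_upwards [Lp.coeFn_smul ((Equiv.Perm.sign σ : ℤ) : ℂ) (ringTensor L N (ψ ∘ σ)),
      coeFn_ringTensor (ψ ∘ σ)] with x hsmul htensor
    rw [hsmul, Pi.smul_apply, htensor]
    rfl
  filter_upwards [hterm, Lp.coeFn_finsetSum Finset.univ fun σ : Equiv.Perm (Fin N) =>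
    ((Equiv.Perm.sign σ : ℤ) : ℂ) • ringTensor L N (ψ ∘ σ)] with x hx hsum
  rw [slaterVec, hsum, Finset.sum_apply, Finset.sum_congr rfl fun σ _ => hx σ, slaterDet_eq_sum]

theorem coeFn_slaterVec_toLp {f : Fin N → ℝ → ℂ}
    (hf : ∀ i, MemLp (f i) 2 ((volume : Measure ℝ).restrict (Set.Ioc 0 L))) :
    slaterVec (fun i => ((hf i).toLp (f i) : RingSpace L)) =ᵐ[ringMeasure L N] slaterDet f := by
  have hcoord : ∀ᵐ x ∂(ringMeasure L N), ∀ j i, (hf i).toLp (f i) (x j) = f i (x j) :=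
    ae_forall_eval fun _ => ae_all_iff.mpr fun i => (hf i).coeFn_toLp
  filter_upwards [coeFn_slaterVec fun i => ((hf i).toLp (f i) : RingSpace L), hcoord] with x hx hc
  simp only [hx, slaterDet, hc]

theorem inner_slaterVec_left (ψ : Fin N → RingSpace L) {f : ConfigSpace L N}
    (hf : ∀ σ : Equiv.Perm (Fin N), permOp L σ f = ((Equiv.Perm.sign σ : ℤ) : ℂ) • f) :
    inner ℂ (slaterVec ψ) f = (N.factorial : ℂ) * inner ℂ (ringTensor L N ψ) f := by
  have hterm : ∀ σ : Equiv.Perm (Fin N),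
      inner ℂ (((Equiv.Perm.sign σ : ℤ) : ℂ) • ringTensor L N (ψ ∘ σ)) f =
        inner ℂ (ringTensor L N ψ) f := fun σ => by
    rw [← (permOp L σ).inner_map_map, map_smul, permOp_ringTensor, hf, inner_smul_left,
      inner_smul_right, ← mul_assoc, map_intCast, sign_mul_sign, one_mul]
  rw [slaterVec, sum_inner, Finset.sum_congr rfl fun σ _ => hterm σ, Finset.sum_const,
    Finset.card_univ, Fintype.card_perm, Fintype.card_fin, nsmul_eq_mul]

theorem permOp_slaterVec (σ : Equiv.Perm (Fin N)) (ψ : Fin N → RingSpace L) :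
    permOp L σ (slaterVec ψ) = ((Equiv.Perm.sign σ : ℤ) : ℂ) • slaterVec ψ := by
  refine Lp.ext ?_
  filter_upwards [coeFn_permOp σ (slaterVec ψ), ae_comp_perm σ (coeFn_slaterVec ψ),
    Lp.coeFn_smul ((Equiv.Perm.sign σ : ℤ) : ℂ) (slaterVec ψ), coeFn_slaterVec ψ]
    with x hperm hψσ hsmul hψ
  rw [hperm, hψσ, hsmul, Pi.smul_apply, hψ, slaterDet_perm, smul_eq_mul]

theorem inner_slaterVec_slaterVec (φ ψ : Fin N → RingSpace L) :
    inner ℂ (slaterVec φ) (slaterVec ψ) =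
      (N.factorial : ℂ) * Matrix.det (Matrix.of fun i j => inner ℂ (φ i) (ψ j)) := by
  rw [inner_slaterVec_left φ fun σ => permOp_slaterVec σ ψ, slaterVec, inner_sum,
    ← Matrix.det_transpose, Matrix.det_apply']
  simp only [inner_smul_right, inner_ringTensor]
  rfl

theorem configEvolution_slaterVec (hL : 0 < L) {n : ℕ} {v : Fin n → ℝ → ℝ}
    (hv : ∀ b, Continuous (v b)) (t : ℝ) (ψ : Fin N → RingSpace L) :
    configEvolution hL hv N t (slaterVec ψ) = slaterVec fun i => ringEvolution hL hv t (ψ i) := by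
  simp only [slaterVec, map_sum, map_smul, configEvolution_ringTensor]
  rfl

/-! ## Uniqueness of the evolution -/

theorem contDiff_slaterDet_ringWave (L : ℝ) (Λ : Fin N → ℤ) :
    ContDiff ℝ 2 (slaterDet fun i => ringWave L (Λ i)) :=
  contDiff_slaterDet fun _ => contDiff_planeWave L _

theorem slaterDet_ringWave_add_period (hL : L ≠ 0) (Λ : Fin N → ℤ) (j : Fin N) (x : Fin N → ℝ) :
    slaterDet (fun i => ringWave L (Λ i)) (Function.update x j (x j + L)) =
      -slaterDet (fun i => ringWave L (Λ i)) x := by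
  rw [slaterDet_update_add (c := -1) fun i s => by rw [ringWave_add_period hL, neg_one_mul],
    neg_one_mul]

theorem isHardcoreTest_slaterDet_ringWave (hL : L ≠ 0) (hN : Even N) (Λ : Fin N → ℤ) :
    IsHardcoreTest L fun x => (signProd x : ℂ) * slaterDet (fun i => ringWave L (Λ i)) x :=
  ⟨_, contDiff_slaterDet_ringWave L Λ, slaterDet_perm _, fun j x => by
    rw [slaterDet_ringWave_add_period hL, hN.add_one.neg_one_pow, neg_one_mul], fun _ => rfl⟩

theorem toLp_slaterDet_ringWave (hL : 0 < L) (Λ : Fin N → ℤ) :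
    ((memLp_of_continuous (contDiff_slaterDet_ringWave L Λ).continuous 2).toLp _ :
      ConfigSpace L N) = slaterVec fun i => ringBasis hL (Λ i) := by
  simp only [ringBasis_apply]
  exact Lp.ext ((MemLp.coeFn_toLp _).trans
    (coeFn_slaterVec_toLp fun i => memLp_planeWave L _ _).symm)

theorem inner_configBasis_slaterVec (hL : 0 < L) (M Λ : Fin N → ℤ) :
    (configEnergy L M : ℂ) *
        inner ℂ (configBasis hL N M) (slaterVec fun i => ringBasis hL (Λ i)) =
      (configEnergy L Λ : ℂ) *
        inner ℂ (configBasis hL N M) (slaterVec fun i => ringBasis hL (Λ i)) := by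
  rw [slaterVec, inner_sum, Finset.mul_sum, Finset.mul_sum]
  refine Finset.sum_congr rfl fun σ _ => ?_
  have hσ : ringTensor L N ((fun i => ringBasis hL (Λ i)) ∘ σ) = configBasis hL N (Λ ∘ σ) :=
    (configBasis_apply hL (Λ ∘ σ)).symm
  rw [inner_smul_right, hσ]
  by_cases h : M = Λ ∘ σ
  · rw [h, configEnergy_perm]
  · rw [(configBasis hL N).orthonormal.2 h, mul_zero, mul_zero, mul_zero]

theorem toLp_kinetic_slaterDet_ringWave (hL : 0 < L) (Λ : Fin N → ℤ) :
    ((memLp_of_continuous (continuous_kinetic (contDiff_slaterDet_ringWave L Λ)) 2).toLp _ :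
      ConfigSpace L N) = (configEnergy L Λ : ℂ) • slaterVec fun i => ringBasis hL (Λ i) := by
  refine eq_of_forall_inner_eq (dense_span_range_hilbertBasis (configBasis hL N)) fun M => ?_
  rw [inner_configBasis_kinetic hL (contDiff_slaterDet_ringWave L Λ)
    (slaterDet_ringWave_add_period hL.ne' Λ), inner_smul_right, toLp_slaterDet_ringWave hL,
    inner_configBasis_slaterVec]

theorem inner_slaterVec_ringBasis (hL : 0 < L) (Λ : Fin N → ℤ) {f : ConfigSpace L N}
    (hf : ∀ σ : Equiv.Perm (Fin N), permOp L σ f = ((Equiv.Perm.sign σ : ℤ) : ℂ) • f) :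
    inner ℂ (slaterVec fun i => ringBasis hL (Λ i)) f =
      (N.factorial : ℂ) * inner ℂ (configBasis hL N Λ) f := by
  rw [inner_slaterVec_left _ hf, configBasis_apply]

variable {n : ℕ} {v : Fin n → ℝ → ℝ} {U : ℝ → BosonSpace L N →L[ℂ] BosonSpace L N}

theorem IsEvolutionOperator.hasDerivAt_inner_configBasis (hU : IsEvolutionOperator L v N U)
    (hL : 0 < L) (hN : Even N) (Ψ : BosonSpace L N) (Λ : Fin N → ℤ) (t : ℝ) :
    HasDerivAt (fun s => inner ℂ (configBasis hL N Λ) (signOp L N (U s Ψ : ConfigSpace L N)))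
      (-I * ((configEnergy L Λ : ℂ) *
          inner ℂ (configBasis hL N Λ) (signOp L N (U t Ψ : ConfigSpace L N)) +
        inner ℂ (configBasis hL N Λ)
          (configPotential L N v t (signOp L N (U t Ψ : ConfigSpace L N))))) t := by
  have hpot : ∀ σ : Equiv.Perm (Fin N),
      permOp L σ (configPotential L N v t (signOp L N (U t Ψ : ConfigSpace L N))) =
        ((Equiv.Perm.sign σ : ℤ) : ℂ) •
          configPotential L N v t (signOp L N (U t Ψ : ConfigSpace L N)) := fun σ => by
    rw [permOp_configPotential, permOp_signOp_boson, map_smul]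
  have hg := contDiff_slaterDet_ringWave L Λ
  have h := hU.schrodinger Ψ _ (isHardcoreTest_slaterDet_ringWave hL.ne' hN Λ) t
  simp only [integral_conj_mul_of_eq_signProd_mul (memLp_of_continuous hg.continuous 2)
      (fun _ => rfl), integral_conj_hamiltonian_mul v t hg (fun _ => rfl),
    toLp_kinetic_slaterDet_ringWave hL, toLp_slaterDet_ringWave hL, inner_smul_left,
    Complex.conj_ofReal, inner_slaterVec_ringBasis hL Λ fun σ => permOp_signOp_boson σ _,
    inner_slaterVec_ringBasis hL Λ hpot] at h
  have hfactorial : (N.factorial : ℂ) ≠ 0 := Nat.cast_ne_zero.mpr N.factorial_ne_zero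
  have hscaled := h.const_mul (N.factorial : ℂ)⁻¹
  simp only [inv_mul_cancel_left₀ hfactorial] at hscaled
  refine hscaled.congr_deriv ?_
  field_simp

theorem eq_bosonEvolution (hL : 0 < L) (hv : ∀ b, Continuous (v b)) (hN : Even N)
    (hU : IsEvolutionOperator L v N U) : U = bosonEvolution hL hv N := by
  funext t
  ext1 Ψ
  have h := eq_evolution_of_weak_solution (configBasis hL N) (configEnergy L)
    (stronglyContinuous_configPotential L N hv)
    (locallyBounded_of_continuous
      ((signOp L N).continuous.comp (continuous_subtype_val.comp (hU.continuous Ψ))))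
    (hU.hasDerivAt_inner_configBasis hL hN Ψ) t
  refine Subtype.ext ?_
  rw [coe_bosonEvolution, ← signOp_signOp (U t Ψ : ConfigSpace L N)]
  refine congrArg (signOp L N) (h.trans ?_)
  simp only [Function.comp_apply, hU.initial]
  rfl

end

/-! ## Wavelet states -/

section

variable {ι κ : Type*} [Fintype ι] [Fintype κ]

theorem prod_prod_fiber {M : Type*} [CommMonoid M] [DecidableEq κ] (c : ι → κ)
    (F : ∀ b, {j // c j = b} → M) : ∏ b, ∏ j, F b j = ∏ i, F (c i) ⟨i, rfl⟩ := by
  rw [← Fintype.prod_sigma fun p : (Σ b, {j // c j = b}) => F p.1 p.2,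
    ← Equiv.prod_comp (Equiv.sigmaFiberEquiv c).symm]
  rfl

theorem signProd_eq_prod_prod [LinearOrder ι] (x : ι → ℝ) :
    signProd x = ∏ i, ∏ j, if i < j then Real.sign (x i - x j) else 1 := by
  rw [signProd, Finset.prod_filter, Fintype.prod_prod_type]

theorem prod_signProd_fiber [LinearOrder ι] [DecidableEq κ] {c : ι → κ} {x : ι → ℝ}
    (h : ∀ i j, i < j → c i ≠ c j → x j < x i) :
    ∏ b, signProd (fun j : {j // c j = b} => x j) = signProd x := by
  simp only [signProd_eq_prod_prod]
  rw [prod_prod_fiber c fun b i => ∏ j : {j // c j = b}, if i < j then Real.sign (x i - x j) else 1]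
  refine Finset.prod_congr rfl fun i _ => ?_
  have hfiber : ∏ j with c j = c i, (if i < j then Real.sign (x i - x j) else 1) =
      ∏ j : {j // c j = c i}, if i < (j : ι) then Real.sign (x i - x j) else 1 :=
    Finset.prod_subtype _ (by simp) _
  refine hfiber.symm.trans (Finset.prod_subset (Finset.filter_subset _ _) fun j _ hj => ?_)
  have hc : c i ≠ c j := fun hc => hj (Finset.mem_filter.mpr ⟨Finset.mem_univ j, hc.symm⟩)
  split_ifs with hij
  · exact Real.sign_of_pos (sub_pos.mpr (h i j hij hc))
  · rfl

theorem slaterDet_eq_prod_fiber [DecidableEq ι] [LinearOrder κ] {c : ι → κ} {f : ι → ℝ → ℂ}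
    {x : ι → ℝ} (h : ∀ i j, c i ≠ c j → f i (x j) = 0) :
    slaterDet f x = ∏ b, slaterDet (fun i : {j // c j = b} => f i) (fun j => x j) :=
  Matrix.BlockTriangular.det_fintype (M := Matrix.of fun i j => f i (x j)) (b := c)
    fun i j hij => h i j hij.ne'

theorem slaterDet_eq_zero [DecidableEq ι] {f : ι → ℝ → ℂ} {x : ι → ℝ}
    (h : ∀ σ : Equiv.Perm ι, ∃ i, f (σ i) (x i) = 0) : slaterDet f x = 0 := by
  rw [slaterDet_eq_sum]
  refine Finset.sum_eq_zero fun σ _ => ?_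
  obtain ⟨i, hi⟩ := h σ
  rw [Finset.prod_eq_zero (Finset.mem_univ i) hi, mul_zero]

end

theorem waveletFun_of_notMem (L : ℝ) {n : ℕ} {a : WaveletLabel n} {s : ℝ}
    (hs : s ∉ box L n a.2) : waveletFun L a s = 0 :=
  Set.indicator_of_notMem hs _

theorem slaterDet_planeWave {ι : Type*} [Fintype ι] [LinearOrder ι] [DecidableEq ι] (ℓ : ℝ)
    (k x : ι → ℝ) :
    (signProd x : ℂ) * (((Fintype.card ι).factorial : ℂ)⁻¹ *
      slaterDet (fun i => planeWave ℓ (k i)) x) = eigenAmplitude ℓ k x := by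
  have hterm : ∀ σ : Equiv.Perm ι, ∏ i, planeWave ℓ (k (σ i)) (x i) =
      ((Real.sqrt ℓ : ℂ) ^ Fintype.card ι)⁻¹ *
        Complex.exp (I * ∑ i, (x i : ℂ) * (k (σ i) : ℂ)) := fun σ => by
    simp only [planeWave, Finset.prod_mul_distrib, Finset.prod_const, Finset.card_univ,
      ← Complex.exp_sum, Finset.mul_sum, Complex.ofReal_inv, inv_pow, mul_comm (k _ : ℂ)]
  rw [slaterDet_eq_sum, Finset.sum_congr rfl fun σ _ => congrArg _ (hterm σ)]
  simp only [mul_left_comm _ ((Real.sqrt ℓ : ℂ) ^ Fintype.card ι)⁻¹, ← Finset.mul_sum]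
  unfold eigenAmplitude
  push_cast
  rw [mul_inv, mul_comm (signProd x : ℂ), ← mul_assoc, ← mul_assoc,
    mul_comm ((Real.sqrt ℓ : ℂ) ^ Fintype.card ι)⁻¹]
  congr!

theorem signProd_mul_slaterDet_perm {N : ℕ} (f : Fin N → ℝ → ℂ) (σ : Equiv.Perm (Fin N))
    (x : Fin N → ℝ) :
    (signProd (x ∘ σ) : ℂ) * slaterDet f (x ∘ σ) = (signProd x : ℂ) * slaterDet f x := by
  rw [signProd_perm, slaterDet_perm, Complex.ofReal_mul, Complex.ofReal_intCast,
    mul_mul_mul_comm, sign_mul_sign, one_mul]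

section

variable {L : ℝ} {n N : ℕ} {α : Fin N → WaveletLabel n} {x : Fin N → ℝ}

theorem waveletAmplitude_of_notMem (hx : ¬∀ j, x j ∈ box L n (α j).2) :
    waveletAmplitude L α x = 0 := by
  obtain ⟨j, hj⟩ := not_forall.mp hx
  have hzero : (box L n (α j).2).indicator (fun _ => (1 : ℂ)) (x j) = 0 :=
    Set.indicator_of_notMem hj _
  refine Finset.prod_eq_zero (Finset.mem_univ (α j).2) (mul_eq_zero_of_right _ ?_)
  exact Finset.prod_eq_zero (Finset.mem_univ (⟨j, rfl⟩ : {i // (α i).2 = (α j).2})) hzero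

theorem waveletAmplitude_of_mem (hL : 0 < L) (hα : Antitone fun i => (α i).2)
    (hx : ∀ j, x j ∈ box L n (α j).2) :
    waveletAmplitude L α x = (signProd x : ℂ) *
      ((∏ b, ((Fintype.card {j // (α j).2 = b}).factorial : ℂ))⁻¹ *
        slaterDet (fun i => waveletFun L (α i)) x) := by
  have hfiber : ∀ b, eigenAmplitude (L / n) (fun j : {j // (α j).2 = b} => momentum L (α j))
        (fun j => x j) * ∏ j : {j // (α j).2 = b}, (box L n b).indicator (fun _ => (1 : ℂ)) (x j) =
      (signProd fun j : {j // (α j).2 = b} => x j : ℂ) *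
        (((Fintype.card {j // (α j).2 = b}).factorial : ℂ)⁻¹ *
          slaterDet (fun i : {j // (α j).2 = b} => waveletFun L (α i)) fun j => x j) := fun b => by
    have hmem : ∀ i j : {j // (α j).2 = b}, x j ∈ box L n (α i).2 := fun i j =>
      i.2.trans j.2.symm ▸ hx j
    have hwave : slaterDet (fun i : {j // (α j).2 = b} => waveletFun L (α i)) (fun j => x j) =
        slaterDet (fun i : {j // (α j).2 = b} => planeWave (L / n) (momentum L (α i)))
          fun j => x j :=
      congrArg Matrix.det (Matrix.ext fun i j => Set.indicator_of_mem (hmem i j) _)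
    rw [hwave, slaterDet_planeWave, Finset.prod_eq_one, mul_one]
    exact fun j _ => Set.indicator_of_mem (by simpa only [j.2] using hx j) _
  have hsign : ∀ i j, i < j → (α i).2 ≠ (α j).2 → x j < x i := fun i j hij hne =>
    lt_of_mem_box hL (lt_of_le_of_ne (hα hij.le) hne.symm) (hx j) (hx i)
  have hblock : ∀ i j, (α i).2 ≠ (α j).2 → waveletFun L (α i) (x j) = 0 := fun i j hne =>
    waveletFun_of_notMem L fun hmem => hne (eq_of_mem_box hL hmem (hx j))
  rw [waveletAmplitude, Finset.prod_congr rfl fun b _ => hfiber b, Finset.prod_mul_distrib,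
    Finset.prod_mul_distrib, Finset.prod_inv_distrib, slaterDet_eq_prod_fiber hblock,
    ← prod_signProd_fiber hsign, Complex.ofReal_prod]

open Classical in
theorem card_perm_mem_box (hL : 0 < L) (hx : ∀ j, x j ∈ box L n (α j).2) :
    Finset.card {κ : Equiv.Perm (Fin N) | ∀ j, x (κ j) ∈ box L n (α j).2} =
      ∏ b, (Fintype.card {j // (α j).2 = b}).factorial := by
  rw [← DomMulAct.stabilizer_card fun j => (α j).2, Fintype.card_subtype]
  congr! 2 with κ
  rw [funext_iff]
  exact forall_congr' fun j => ⟨fun hmem => eq_of_mem_box hL (hx (κ j)) hmem,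
    fun heq => heq ▸ hx (κ j)⟩

theorem sum_waveletAmplitude_perm_of_mem (hL : 0 < L) (hα : Antitone fun i => (α i).2)
    (hx : ∀ j, x j ∈ box L n (α j).2) :
    ∑ κ : Equiv.Perm (Fin N), waveletAmplitude L α (x ∘ κ) =
      (signProd x : ℂ) * slaterDet (fun i => waveletFun L (α i)) x := by
  classical
  set C : ℂ := ∏ b, ((Fintype.card {j // (α j).2 = b}).factorial : ℂ) with hC
  have hC0 : C ≠ 0 := Finset.prod_ne_zero_iff.mpr fun b _ =>
    Nat.cast_ne_zero.mpr (Nat.factorial_ne_zero _)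
  have hterm : ∀ κ : Equiv.Perm (Fin N), waveletAmplitude L α (x ∘ κ) =
      if ∀ j, x (κ j) ∈ box L n (α j).2 then
        (signProd x : ℂ) * (C⁻¹ * slaterDet (fun i => waveletFun L (α i)) x) else 0 := fun κ => by
    split_ifs with hκ
    · rw [waveletAmplitude_of_mem (x := x ∘ κ) hL hα hκ, mul_left_comm, signProd_mul_slaterDet_perm,
        mul_left_comm]
    · exact waveletAmplitude_of_notMem hκ
  rw [Finset.sum_congr rfl fun κ _ => hterm κ, ← Finset.sum_filter, Finset.sum_const,
    card_perm_mem_box hL hx, nsmul_eq_mul, Nat.cast_prod, ← hC, mul_left_comm,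
    mul_inv_cancel_left₀ hC0]

theorem sum_waveletAmplitude_perm (hL : 0 < L) (hα : Antitone fun i => (α i).2)
    (x : Fin N → ℝ) :
    ∑ κ : Equiv.Perm (Fin N), waveletAmplitude L α (x ∘ κ) =
      (signProd x : ℂ) * slaterDet (fun i => waveletFun L (α i)) x := by
  by_cases h : ∃ κ₀ : Equiv.Perm (Fin N), ∀ j, x (κ₀ j) ∈ box L n (α j).2
  · obtain ⟨κ₀, hκ₀⟩ := h
    rw [← signProd_mul_slaterDet_perm _ κ₀,
      ← sum_waveletAmplitude_perm_of_mem (x := x ∘ κ₀) hL hα hκ₀]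
    exact (Equiv.sum_comp (Equiv.mulLeft κ₀) fun κ => waveletAmplitude L α (x ∘ κ)).symm
  · rw [not_exists] at h
    have hdet : slaterDet (fun i => waveletFun L (α i)) x = 0 := slaterDet_eq_zero fun σ => by
      obtain ⟨i, hi⟩ := not_forall.mp (h σ.symm)
      exact ⟨σ.symm i, waveletFun_of_notMem L (by rwa [σ.apply_symm_apply])⟩
    rw [hdet, mul_zero]
    exact Finset.sum_eq_zero fun κ _ => waveletAmplitude_of_notMem (h κ)

theorem signOp_waveletState (hL : 0 < L) (hn : 0 < n) (hα : Antitone fun i => (α i).2) :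
    signOp L N (waveletState L α : ConfigSpace L N) =
      (((Real.sqrt (N.factorial : ℝ))⁻¹ : ℝ) : ℂ) •
        slaterVec fun i => waveletBasis hL hn (α i) := by
  simp only [waveletBasis_apply]
  refine Lp.ext ?_
  filter_upwards [coeFn_signOp (waveletState L α : ConfigSpace L N),
    (memLp_bosonize (memLp_waveletAmplitude L α)).coeFn_toLp, ae_ringMeasure_injective L N,
    Lp.coeFn_smul (((Real.sqrt (N.factorial : ℝ))⁻¹ : ℝ) : ℂ)
      (slaterVec fun i => (memLp_waveletFun L (α i) _).toLp _ : ConfigSpace L N),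
    coeFn_slaterVec_toLp fun i => memLp_waveletFun L (α i) _]
    with x hsign hstate hinj hsmul hslater
  rw [hsign, hsmul, Pi.smul_apply, hslater, smul_eq_mul]
  refine (congrArg _ hstate).trans ?_
  rw [bosonize, sum_waveletAmplitude_perm hL hα, mul_left_comm, ← mul_assoc (signProd x : ℂ),
    ← Complex.ofReal_mul, signProd_mul_self hinj, Complex.ofReal_one, one_mul]

end

theorem inner_waveletState_bosonEvolution {L : ℝ} (hL : 0 < L) {n N : ℕ} (hn : 0 < n)
    {v : Fin n → ℝ → ℝ} (hv : ∀ b, Continuous (v b)) (t : ℝ) {α β : Fin N → WaveletLabel n}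
    (hα : Antitone fun i => (α i).2) (hβ : Antitone fun i => (β i).2) :
    inner ℂ (waveletState L α) (bosonEvolution hL hv N t (waveletState L β)) =
      Matrix.det (Matrix.of fun i j => inner ℂ (waveletBasis hL hn (α i))
        (ringEvolution hL hv t (waveletBasis hL hn (β j)))) := by
  have hN : (0 : ℝ) < N.factorial := Nat.cast_pos.mpr N.factorial_pos
  have hnorm : (((Real.sqrt (N.factorial : ℝ))⁻¹ : ℝ) : ℂ) *
      ((((Real.sqrt (N.factorial : ℝ))⁻¹ : ℝ) : ℂ) * N.factorial) = 1 := by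
    rw [← mul_assoc, ← Complex.ofReal_mul, ← mul_inv, Real.mul_self_sqrt hN.le]
    push_cast
    exact inv_mul_cancel₀ (by exact_mod_cast hN.ne')
  rw [Submodule.coe_inner, coe_bosonEvolution, ← inner_signOp_left, signOp_waveletState hL hn hα,
    signOp_waveletState hL hn hβ, map_smul, configEvolution_slaterVec, inner_smul_left,
    inner_smul_right, inner_slaterVec_slaterVec, Complex.conj_ofReal,
    ← mul_assoc _ (N.factorial : ℂ), ← mul_assoc, hnorm, one_mul]

end HardcoreBosons

end

theorem theorem1 (L : ℝ) (hL : 0 < L) (n : ℕ) (hn : 0 < n)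
    (v : Fin n → ℝ → ℝ) (hv : ∀ b, Continuous (v b)) :
    -- the series for `G_t` and `U_t` converge absolutely
    (∀ (t : ℝ) (a c : HardcoreBosons.WaveletLabel n),
      Summable (HardcoreBosons.greenTerm L t a c)) ∧
    (∀ (t : ℝ) (a c : HardcoreBosons.WaveletLabel n),
      Summable fun g : HardcoreBosons.WaveletLabel n =>
        HardcoreBosons.green L (-t) a g * (v g.2 t : ℂ) * HardcoreBosons.green L t g c) ∧
    -- the differential equation has exactly one solution, and its series converge absolutely
    ∃ ψt : ℝ → HardcoreBosons.WaveletLabel n → HardcoreBosons.WaveletLabel n → ℂ,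
      HardcoreBosons.IsInteractionSolution L v ψt ∧
      (∀ ψt', HardcoreBosons.IsInteractionSolution L v ψt' → ψt' = ψt) ∧
      (∀ (t : ℝ) (a c : HardcoreBosons.WaveletLabel n),
        Summable fun ν => HardcoreBosons.generator L v t a ν * ψt t ν c) ∧
      (∀ (t : ℝ) (a c : HardcoreBosons.WaveletLabel n),
        Summable fun g => HardcoreBosons.green L t a g * ψt t g c) ∧
      -- for every even number of particles the evolution operator exists, is unique, and has the
      -- determinantal form factors
      ∀ N : ℕ, Even N →
        ∃ U : ℝ → HardcoreBosons.BosonSpace L N →L[ℂ] HardcoreBosons.BosonSpace L N,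
          HardcoreBosons.IsEvolutionOperator L v N U ∧
          (∀ U', HardcoreBosons.IsEvolutionOperator L v N U' → U' = U) ∧
          ∀ (t : ℝ) (α β : Fin N → HardcoreBosons.WaveletLabel n),
            Function.Injective α → Antitone (fun i => (α i).2) →
            Function.Injective β → Antitone (fun i => (β i).2) →
            inner ℂ (HardcoreBosons.waveletState L α) (U t (HardcoreBosons.waveletState L β)) =
              Matrix.det (Matrix.of fun i j => HardcoreBosons.psi L ψt t (α i) (β j)) := by
  refine ⟨fun t a c => (HardcoreBosons.hasSum_greenTerm hL hn t a c).summable,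
    fun t a c => (HardcoreBosons.hasSum_generator hL hn v t a c).summable,
    HardcoreBosons.interactionMatrix hL hn hv,
    HardcoreBosons.isInteractionSolution_interactionMatrix hL hn hv,
    fun ψ hψ => HardcoreBosons.eq_interactionMatrix hL hn hv hψ,
    HardcoreBosons.summable_generator_mul hL hn hv,
    fun t a c => (HardcoreBosons.hasSum_psi hL hn hv t a c).summable, fun N hN =>
    ⟨HardcoreBosons.bosonEvolution hL hv N,
      HardcoreBosons.isEvolutionOperator_bosonEvolution hL hv hN,
      fun U hU => HardcoreBosons.eq_bosonEvolution hL hv hN hU, fun t α β _ hα _ hβ => ?_⟩⟩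
  simp only [HardcoreBosons.psi_interactionMatrix]
  exact HardcoreBosons.inner_waveletState_bosonEvolution hL hn hv t hα hβ
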